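/- For real $\alpha,\beta>0$ and $x\in\mathbb R$ let $$E_{\alpha,\beta}(x)=\sum_{r=0}^\infty\frac{x^r}{\Gamma(\alpha r+\beta)},\qquad W^{\alpha}_{\beta-1}(x)=\sum_{r=0}^\infty\frac{x^r}{r!\,\Gamma(\alpha r+\beta)}$$ be the Mittag-Leffler and the Bessel-Wright function. Throughout, $1/\Gamma$ is the entire function, so that $\pi/\Gamma(\beta-\alpha/2)=0$ when $\beta-\alpha/2\in\{0,-1,-2,\dots\}$. Let $\alpha,\beta>0$. Then: 1. Both series converge for every $x\in\mathbb R$, and $E_{\alpha,\beta}(x)=\int_0^\infty e^{-s}\,W^{\alpha}_{\beta-1}(xs)\,ds$ for every $x\in\mathbb R$, the integral being absolutely convergent. 2. Whenever the improper integral $\int_{-\infty}^{\infty}E_{\alpha,\beta}(-x^2)\,dx=\lim_{a\to-\infty,\,b\to\infty}\int_a^bE_{\alpha,\beta}(-x^2)\,dx$ converges (to a finite limit), it satisfies $$\int_{-\infty}^{\infty}E_{\alpha,\beta}(-x^2)\,dx=\frac{\pi}{\Gamma\left(\beta-\frac{\alpha}{2}\right)}.$$ 3. This improper integral converges if and only if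 $\alpha<2$, or $\alpha=2$ and $\beta>1$. If $\alpha<2$, it converges absolutely. -/

import Mathlib

open MeasureTheory Filter Topology Set

noncomputable section

/-- The two-parameter Mittag-Leffler function `E_{α,β}(x) = ∑ x ^ r / Γ(α r + β)`. -/
def mittagLeffler (α β x : ℝ) : ℝ :=
  ∑' r : ℕ, x ^ r / Real.Gamma (α * r + β)

/-- The Bessel-Wright function `W^α_β(x) = ∑ x ^ r / (r! Γ(α r + β + 1))`. -/
def besselWright (α β x : ℝ) : ℝ :=
  ∑' r : ℕ, x ^ r / ((r.factorial : ℝ) * Real.Gamma (α * r + β + 1))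

/-- `HasImproperIntegral f I`: the improper integral of `f` over the real line converges to `I`,
the two endpoints tending to `-∞` and `+∞` independently of each other. (The functions it is
applied to are continuous, so the integrals over bounded intervals are ordinary ones.) -/
def HasImproperIntegral (f : ℝ → ℝ) (I : ℝ) : Prop :=
  (∀ a b : ℝ, IntervalIntegrable f volume a b) ∧
    Tendsto (fun p : ℝ × ℝ => ∫ x in p.1..p.2, f x) (atBot ×ˢ atTop) (𝓝 I)

end

/-!
Write `F_β(x) = E_{α,β}(-x²)`. Since `F_β` is even, everything reduces to the behaviour at `+∞` of
the primitive `P_β(b) = ∫₀ᵇ F_β`, an odd power series (`hasImproperIntegral_iff_tendsto`). The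
identity `Γ(s + 1) = s Γ(s)` gives `P_β = (β - α/2) P_{β+1} + (α/2) x F_{β+1}`
(`oddSeries_intCoeff_eq`), by which limits are transported in `β`. The elementary bound
`1 / Γ(s) ≤ s e^Y Y^{-s}` controls convergence and growth of all series, and justifies the termwise
integration behind the Borel transform.

*`α < 2`.* Fourier inversion yields the Bromwich formula `1 / Γ(B) = ∫ e^w w^{-B}` over a vertical
line (`integral_cexp_mul_cpow_line`). Summed against a binomial series it represents
`E^{j+1}_{α,B}(-x²)` as `∫ e^w w^{-B} (1 + x² w^{-α})^{-j-1}`. As `|arg w^{-α}| ≤ πα/2 < π` for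
`Re w > 0`, the last factor has no pole there, and the line can be fixed independently of `x`. For
`B > 1 + α` this shows decay like `1 / (1 + x²)`, and by Fubini and `∫ dx / (1 + x²/p²) = π p` the
value of the integral. Smaller parameters are reached by recursion: lowering `B` raises `j`
(`prabhakar_eq`), which is why the whole family in `j` is considered; the value descends through the
recursion for `P_β`.

*`α = 2`.* Fractional integration raises `β` (`integral_mul_oddSeries`) and is a weighted average of
dilates, so it preserves convergence at infinity when the weight is integrable. Applied to the Dirichlet integral (`β = 2`) it gives the
limit for `β > 2`; the recursion and the Riemann-Lebesgue lemma extend it to `β > 1`. For `β ≤ 1`,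
convergence of `P_β` would imply that of `x F_{β+1}`, and fractional integration of order `1 - β`
turns the latter into `sin x`, which has no limit.

*`α > 2`.* If `P_β` converges it is bounded on the real line. It extends to an entire function of
order `2/α < 1`, so by Phragmén-Lindelöf it is bounded in both half planes, hence constant by
Liouville (`not_tendsto_oddSeries_of_two_lt`). But `P_β'(0) = 1 / Γ(β) ≠ 0`.
-/

section

variable {α β : ℝ}

/-! ### Bounds for the reciprocal Gamma function -/

/-- The reciprocal of the Gamma function is bounded by `s e^Y Y ^ (-s)` for every `Y > 0`; the
freedom in `Y` yields both the convergence of the series below and their order of growth. -/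
lemma inv_Gamma_le_mul_exp_mul_rpow {s Y : ℝ} (hs : 0 < s) (hY : 0 < Y) :
    (Real.Gamma s)⁻¹ ≤ s * (Real.exp Y * Y ^ (-s)) := by
  have hG : 0 < Real.Gamma s := Real.Gamma_pos_of_pos hs
  have hint : Y ^ s * Real.exp (-Y) ≤ Real.Gamma (s + 1) := by
    rw [Real.Gamma_eq_integral (by linarith)]
    have hconv := Real.GammaIntegral_convergent (show 0 < s + 1 by linarith)
    calc Y ^ s * Real.exp (-Y) = ∫ t in Ioi Y, Real.exp (-t) * Y ^ s := by
          rw [integral_mul_const, integral_exp_neg_Ioi, mul_comm]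
      _ ≤ ∫ t in Ioi Y, Real.exp (-t) * t ^ (s + 1 - 1) := by
          refine setIntegral_mono_on ((integrableOn_exp_neg_Ioi Y).mul_const _)
            (hconv.mono_set (Ioi_subset_Ioi hY.le)) measurableSet_Ioi fun t ht => ?_
          rw [add_sub_cancel_right]
          have := Real.rpow_le_rpow hY.le (le_of_lt ht) hs.le
          gcongr
      _ ≤ ∫ t in Ioi 0, Real.exp (-t) * t ^ (s + 1 - 1) := by
          refine setIntegral_mono_set hconv ?_ (Ioi_subset_Ioi hY.le).eventuallyLE
          filter_upwards [ae_restrict_mem measurableSet_Ioi] with t ht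
          have : (0 : ℝ) < t := ht
          positivity
  rw [Real.Gamma_add_one hs.ne'] at hint
  rw [inv_le_iff_one_le_mul₀ hG, Real.rpow_neg hY.le]
  have h1 : Y ^ s * Real.exp (-Y) * (Real.exp Y * (Y ^ s)⁻¹) = 1 := by
    have : Y ^ s ≠ 0 := (Real.rpow_pos_of_pos hY s).ne'
    rw [Real.exp_neg]; field_simp
  calc (1 : ℝ) = Y ^ s * Real.exp (-Y) * (Real.exp Y * (Y ^ s)⁻¹) := h1.symm
    _ ≤ s * Real.Gamma s * (Real.exp Y * (Y ^ s)⁻¹) := by gcongr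
    _ = _ := by ring

lemma summable_affine_mul_geometric (α β : ℝ) :
    Summable fun r : ℕ => (α * r + β) * (1 / 2 : ℝ) ^ r := by
  have h1 := summable_pow_mul_geometric_of_norm_lt_one 1 (r := (1 / 2 : ℝ)) (by norm_num)
  have h0 := summable_geometric_of_lt_one (r := (1 / 2 : ℝ)) (by norm_num) (by norm_num)
  refine ((h1.mul_left α).add (h0.mul_left β)).congr fun r => ?_
  simp; ring

lemma gammaArg_pos (hα : 0 < α) (hβ : 0 < β) (r : ℕ) : 0 < α * r + β := by positivity

/-- Termwise majorant of the Mittag-Leffler series: it is the bound for `1 / Γ` at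
`Y = (2 y) ^ (1 / α)`, which turns `y ^ r` into a geometric sequence. -/
lemma pow_div_Gamma_le (hα : 0 < α) (hβ : 0 < β) {y : ℝ} (hy : 0 < y) (r : ℕ) :
    y ^ r / Real.Gamma (α * r + β) ≤
      Real.exp ((2 * y) ^ (1 / α)) * ((2 * y) ^ (1 / α)) ^ (-β) *
        ((α * r + β) * (1 / 2 : ℝ) ^ r) := by
  set Y := (2 * y) ^ (1 / α) with hYdef
  have hY : 0 < Y := by positivity
  have hYr : Y ^ (-(α * r + β)) = (1 / 2 : ℝ) ^ r * (y ^ r)⁻¹ * Y ^ (-β) := by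
    have : -(α * r + β) = (-α) * r + (-β) := by ring
    rw [this, Real.rpow_add hY, Real.rpow_mul hY.le, Real.rpow_natCast]
    have hYα : Y ^ (-α) = (2 * y) ^ (1 / α * -α) := (Real.rpow_mul (by positivity) _ _).symm
    rw [hYα]
    have : 1 / α * -α = -1 := by field_simp
    rw [this, Real.rpow_neg_one, mul_inv, mul_pow, inv_pow y, one_div 2]
  have h := inv_Gamma_le_mul_exp_mul_rpow (gammaArg_pos hα hβ r) hY
  rw [div_eq_mul_inv]
  calc y ^ r * (Real.Gamma (α * r + β))⁻¹
      ≤ y ^ r * ((α * r + β) * (Real.exp Y * Y ^ (-(α * r + β)))) := by gcongr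
    _ = _ := by rw [hYr]; field_simp

lemma summable_pow_div_Gamma_of_pos (hα : 0 < α) (hβ : 0 < β) {y : ℝ} (hy : 0 < y) :
    Summable fun r : ℕ => y ^ r / Real.Gamma (α * r + β) := by
  refine Summable.of_nonneg_of_le (fun r => ?_) (pow_div_Gamma_le hα hβ hy)
    ((summable_affine_mul_geometric α β).mul_left _)
  have := Real.Gamma_pos_of_pos (gammaArg_pos hα hβ r)
  positivity

lemma summable_pow_div_Gamma (hα : 0 < α) (hβ : 0 < β) (x : ℝ) :
    Summable fun r : ℕ => x ^ r / Real.Gamma (α * r + β) := by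
  refine Summable.of_norm_bounded
    (summable_pow_div_Gamma_of_pos hα hβ (y := |x| + 1) (by positivity)) fun r => ?_
  have := Real.Gamma_pos_of_pos (gammaArg_pos hα hβ r)
  rw [norm_div, norm_pow, Real.norm_eq_abs, Real.norm_eq_abs, abs_of_pos this]
  gcongr
  linarith

/-- On `[1, ∞)` the Mittag-Leffler series grows at most like `exp ((2 y) ^ (1 / α))`. -/
lemma exists_tsum_pow_div_Gamma_le (hα : 0 < α) (hβ : 0 < β) :
    ∃ C : ℝ, ∀ y : ℝ, 1 ≤ y →
      ∑' r : ℕ, y ^ r / Real.Gamma (α * r + β) ≤ C * Real.exp ((2 * y) ^ (1 / α)) := by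
  refine ⟨∑' r : ℕ, (α * r + β) * (1 / 2 : ℝ) ^ r, fun y hy => ?_⟩
  have hy0 : 0 < y := by linarith
  rw [mul_comm, ← tsum_mul_left]
  refine (summable_pow_div_Gamma_of_pos hα hβ hy0).tsum_le_tsum (fun r => ?_)
    ((summable_affine_mul_geometric α β).mul_left _)
  refine (pow_div_Gamma_le hα hβ hy0 r).trans ?_
  have h1 : 1 ≤ (2 * y) ^ (1 / α) := Real.one_le_rpow (by linarith) (by positivity)
  have h2 : ((2 * y) ^ (1 / α)) ^ (-β) ≤ 1 := Real.rpow_le_one_of_one_le_of_nonpos h1 (by linarith)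
  have := gammaArg_pos hα hβ r
  have h3 : Real.exp ((2 * y) ^ (1 / α)) * ((2 * y) ^ (1 / α)) ^ (-β)
      ≤ Real.exp ((2 * y) ^ (1 / α)) * 1 := by gcongr
  rw [mul_one] at h3
  gcongr

/-- `1 / Γ(α r + β)` decays faster than any geometric sequence. -/
lemma exists_inv_Gamma_le_mul_pow (hα : 0 < α) (hβ : 0 < β) {ρ : ℝ} (hρ : 0 < ρ) :
    ∃ C : ℝ, 0 ≤ C ∧ ∀ r : ℕ, (Real.Gamma (α * r + β))⁻¹ ≤ C * ρ ^ r := by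
  have hs := summable_pow_div_Gamma_of_pos hα hβ (inv_pos.mpr hρ)
  have hnn : ∀ r : ℕ, 0 ≤ ρ⁻¹ ^ r / Real.Gamma (α * r + β) := fun r => by
    have := Real.Gamma_pos_of_pos (gammaArg_pos hα hβ r)
    positivity
  refine ⟨∑' r : ℕ, ρ⁻¹ ^ r / Real.Gamma (α * r + β), tsum_nonneg hnn, fun r => ?_⟩
  have h := hs.le_tsum r fun i _ => hnn i
  rw [← div_le_iff₀ (by positivity)]
  refine le_trans (le_of_eq ?_) h
  rw [inv_pow]; field_simp

/-! ### The Borel transform of the Bessel-Wright function -/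

lemma summable_besselWright (hα : 0 < α) (hβ : 0 < β) (x : ℝ) :
    Summable fun r : ℕ => x ^ r / ((r.factorial : ℝ) * Real.Gamma (α * r + β)) := by
  refine Summable.of_norm_bounded (summable_pow_div_Gamma hα hβ |x|) fun r => ?_
  have hG := Real.Gamma_pos_of_pos (gammaArg_pos hα hβ r)
  have hf : (1 : ℝ) ≤ r.factorial := by exact_mod_cast r.factorial_pos
  rw [norm_div, norm_pow, Real.norm_of_nonneg (r := _ * _) (by positivity), Real.norm_eq_abs]
  gcongr
  nlinarith

lemma exists_abs_besselWright_le (hα : 0 < α) (hβ : 0 < β) {ρ : ℝ} (hρ : 0 < ρ) :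
    ∃ C : ℝ, 0 ≤ C ∧ ∀ y : ℝ,
      |∑' r : ℕ, y ^ r / ((r.factorial : ℝ) * Real.Gamma (α * r + β))| ≤
        C * Real.exp (ρ * |y|) := by
  obtain ⟨C, hC, h⟩ := exists_inv_Gamma_le_mul_pow hα hβ hρ
  refine ⟨C, hC, fun y => ?_⟩
  have he : HasSum (fun r : ℕ => C * ((ρ * |y|) ^ r / r.factorial)) (C * Real.exp (ρ * |y|)) := by
    rw [Real.exp_eq_exp_ℝ]
    exact (NormedSpace.expSeries_div_hasSum_exp (ρ * |y|)).mul_left C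
  rw [← Real.norm_eq_abs]
  refine tsum_of_norm_bounded he fun r => ?_
  have hG := Real.Gamma_pos_of_pos (gammaArg_pos hα hβ r)
  rw [norm_div, norm_pow, Real.norm_of_nonneg (r := _ * _) (by positivity), Real.norm_eq_abs]
  calc |y| ^ r / ((r.factorial : ℝ) * Real.Gamma (α * r + β))
      = |y| ^ r / r.factorial * (Real.Gamma (α * r + β))⁻¹ := by field_simp
    _ ≤ |y| ^ r / r.factorial * (C * ρ ^ r) := by gcongr; exact h r
    _ = _ := by rw [mul_pow]; ring

lemma continuous_tsum_besselWright (hα : 0 < α) (hβ : 0 < β) :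
    Continuous fun y : ℝ => ∑' r : ℕ, y ^ r / ((r.factorial : ℝ) * Real.Gamma (α * r + β)) := by
  rw [continuous_iff_continuousAt]
  intro y₀
  have hc : ContinuousOn
      (fun y : ℝ => ∑' r : ℕ, y ^ r / ((r.factorial : ℝ) * Real.Gamma (α * r + β)))
      (Metric.ball 0 (|y₀| + 1)) := by
    refine continuousOn_tsum (fun r => by fun_prop)
      (summable_besselWright hα hβ (|y₀| + 1)) fun r y hy => ?_
    have hG := Real.Gamma_pos_of_pos (gammaArg_pos hα hβ r)
    rw [mem_ball_zero_iff] at hy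
    rw [norm_div, norm_pow, Real.norm_of_nonneg (r := _ * _) (by positivity)]
    gcongr
  exact hc.continuousAt (Metric.isOpen_ball.mem_nhds (by simp))

lemma integral_exp_neg_mul_pow (r : ℕ) :
    ∫ s in Ioi (0 : ℝ), Real.exp (-s) * s ^ r = r.factorial := by
  rw [← Real.Gamma_nat_eq_factorial, Real.Gamma_eq_integral (by positivity)]
  simp

lemma integrableOn_exp_neg_mul_pow (r : ℕ) :
    IntegrableOn (fun s : ℝ => Real.exp (-s) * s ^ r) (Ioi 0) := by
  have := Real.GammaIntegral_convergent (show 0 < (r : ℝ) + 1 by positivity)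
  simpa using this

lemma integrableOn_exp_neg_mul_besselWright (hα : 0 < α) (hβ : 0 < β) (x : ℝ) :
    IntegrableOn (fun s : ℝ => Real.exp (-s) * besselWright α (β - 1) (x * s)) (Ioi 0) := by
  obtain ⟨C, hC, h⟩ := exists_abs_besselWright_le hα hβ (ρ := 1 / (2 * (|x| + 1))) (by positivity)
  have hint : IntegrableOn (fun s : ℝ => C * Real.exp (-(1 / 2) * s)) (Ioi 0) :=
    (integrableOn_exp_mul_Ioi (by norm_num) 0).const_mul C
  have hcont := continuous_tsum_besselWright hα hβ
  simp only [besselWright, add_assoc, sub_add_cancel]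
  refine hint.mono' ?_ ?_
  · have := hcont.comp (continuous_const_mul x)
    exact ((by fun_prop : Continuous fun s : ℝ => Real.exp (-s)).mul this).aestronglyMeasurable
  · filter_upwards [ae_restrict_mem measurableSet_Ioi] with s hs
    have hs' : (0 : ℝ) < s := hs
    rw [norm_mul, Real.norm_eq_abs, Real.norm_eq_abs, Real.abs_exp]
    have hexp : 1 / (2 * (|x| + 1)) * |x * s| ≤ s / 2 := by
      rw [abs_mul, abs_of_pos hs', div_mul_eq_mul_div, one_mul, div_le_iff₀ (by positivity)]
      nlinarith [abs_nonneg x]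
    calc _ ≤ Real.exp (-s) * (C * Real.exp (s / 2)) := by
          refine mul_le_mul_of_nonneg_left ((h (x * s)).trans ?_) (Real.exp_pos _).le
          gcongr
      _ = C * Real.exp (-(1 / 2) * s) := by
          rw [mul_left_comm, ← Real.exp_add]; congr 2; ring

lemma mittagLeffler_eq_integral_besselWright (hα : 0 < α) (hβ : 0 < β) (x : ℝ) :
    mittagLeffler α β x =
      ∫ s in Ioi (0 : ℝ), Real.exp (-s) * besselWright α (β - 1) (x * s) := by
  simp only [besselWright, add_assoc, sub_add_cancel, mittagLeffler]
  have hF : ∀ (r : ℕ) (s : ℝ),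
      Real.exp (-s) * ((x * s) ^ r / ((r.factorial : ℝ) * Real.Gamma (α * r + β))) =
      Real.exp (-s) * s ^ r * (x ^ r / ((r.factorial : ℝ) * Real.Gamma (α * r + β))) := by
    intro r s; rw [mul_pow]; ring
  have hval : ∀ (r : ℕ) (y : ℝ), (∫ s in Ioi (0 : ℝ), Real.exp (-s) * s ^ r *
      (y ^ r / ((r.factorial : ℝ) * Real.Gamma (α * r + β)))) =
      y ^ r / Real.Gamma (α * r + β) := by
    intro r y
    rw [integral_mul_const, integral_exp_neg_mul_pow]
    have : (r.factorial : ℝ) ≠ 0 := by positivity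
    field_simp
  simp_rw [← tsum_mul_left, hF]
  rw [← integral_tsum_of_summable_integral_norm]
  · simp_rw [hval]
  · exact fun r => (integrableOn_exp_neg_mul_pow r).mul_const _
  · refine (summable_pow_div_Gamma hα hβ |x|).congr fun r => ?_
    rw [← hval]
    refine setIntegral_congr_fun measurableSet_Ioi fun s hs => ?_
    have hs' : (0 : ℝ) < s := hs
    have hG := Real.Gamma_pos_of_pos (gammaArg_pos hα hβ r)
    simp only [norm_mul, norm_div, norm_pow, Real.norm_eq_abs, Real.abs_exp, abs_of_pos hs',
      abs_of_pos hG, Nat.abs_cast]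

/-! ### Odd series and the primitive of `E (-x ^ 2)` -/

/-- The odd power series `∑ a_r x ^ (2 r + 1) / Γ(α r + β)`. The two coefficient sequences used
below are `intCoeff`, giving `∫₀ˣ E_{α,β}(-t²) dt`, and `altCoeff`, giving `x E_{α,β}(-x²)`. -/
noncomputable def oddSeries (a : ℕ → ℝ) (α β x : ℝ) : ℝ :=
  ∑' r : ℕ, a r * x ^ (2 * r + 1) / Real.Gamma (α * r + β)

/-- The signs `(-1) ^ r`. -/
def altCoeff (r : ℕ) : ℝ := (-1) ^ r

/-- The coefficients `(-1) ^ r / (2 r + 1)` produced by integrating `(-x ^ 2) ^ r`. -/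
noncomputable def intCoeff (r : ℕ) : ℝ := (-1) ^ r / (2 * r + 1)

lemma abs_altCoeff_le (r : ℕ) : |altCoeff r| ≤ 1 := by simp [altCoeff]

lemma abs_intCoeff_le (r : ℕ) : |intCoeff r| ≤ 1 := by
  have h : (1 : ℝ) ≤ 2 * r + 1 := by linarith [(Nat.cast_nonneg r : (0 : ℝ) ≤ r)]
  rw [intCoeff, abs_div, abs_pow, abs_neg, abs_one, one_pow, abs_of_pos (by linarith)]
  exact (div_le_one (by linarith)).mpr h

lemma norm_oddSeries_term_le (hα : 0 < α) (hβ : 0 < β) {a : ℕ → ℝ} (ha : ∀ r, |a r| ≤ 1)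
    {x R : ℝ} (hx : |x| ≤ R) (r : ℕ) :
    ‖a r * x ^ (2 * r + 1) / Real.Gamma (α * r + β)‖ ≤
      R * ((R ^ 2) ^ r / Real.Gamma (α * r + β)) := by
  have hG := Real.Gamma_pos_of_pos (gammaArg_pos hα hβ r)
  have hR : 0 ≤ R := (abs_nonneg x).trans hx
  rw [norm_div, norm_mul, norm_pow, Real.norm_of_nonneg hG.le, Real.norm_eq_abs, Real.norm_eq_abs,
    ← mul_div_assoc, ← pow_mul, ← pow_succ']
  gcongr
  calc |a r| * |x| ^ (2 * r + 1) ≤ 1 * R ^ (2 * r + 1) := by gcongr; exact ha r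
    _ = _ := one_mul _

lemma summable_oddSeries (hα : 0 < α) (hβ : 0 < β) {a : ℕ → ℝ} (ha : ∀ r, |a r| ≤ 1) (x : ℝ) :
    Summable fun r : ℕ => a r * x ^ (2 * r + 1) / Real.Gamma (α * r + β) :=
  ((summable_pow_div_Gamma hα hβ (|x| ^ 2)).mul_left |x|).of_norm_bounded
    (norm_oddSeries_term_le hα hβ ha le_rfl)

lemma continuous_oddSeries (hα : 0 < α) (hβ : 0 < β) {a : ℕ → ℝ} (ha : ∀ r, |a r| ≤ 1) :
    Continuous (oddSeries a α β) := by
  rw [continuous_iff_continuousAt]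
  intro y₀
  have hc : ContinuousOn (oddSeries a α β) (Metric.ball 0 (|y₀| + 1)) := by
    refine continuousOn_tsum (fun r => by fun_prop)
      ((summable_pow_div_Gamma hα hβ ((|y₀| + 1) ^ 2)).mul_left (|y₀| + 1)) fun r y hy => ?_
    rw [mem_ball_zero_iff] at hy
    exact norm_oddSeries_term_le hα hβ ha hy.le r
  exact hc.continuousAt (Metric.isOpen_ball.mem_nhds (by simp))

lemma oddSeries_neg (a : ℕ → ℝ) (x : ℝ) : oddSeries a α β (-x) = -oddSeries a α β x := by
  rw [oddSeries, oddSeries, ← tsum_neg]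
  refine tsum_congr fun r => ?_
  rw [Odd.neg_pow ⟨r, rfl⟩]; ring

/-- An odd series that converges at infinity is bounded. -/
lemma exists_abs_oddSeries_le (hα : 0 < α) (hβ : 0 < β) {a : ℕ → ℝ} (ha : ∀ r, |a r| ≤ 1) {L : ℝ}
    (hL : Tendsto (oddSeries a α β) atTop (𝓝 L)) : ∃ M : ℝ, ∀ x : ℝ, |oddSeries a α β x| ≤ M := by
  have hcont := continuous_oddSeries hα hβ ha
  obtain ⟨N, hN⟩ := eventually_atTop.mp (hL.abs.eventually_le_const (lt_add_one |L|))
  obtain ⟨K, hK⟩ := (isCompact_Icc (a := 0) (b := N)).exists_bound_of_continuousOn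
    hcont.continuousOn
  have hpos : ∀ x : ℝ, 0 ≤ x → |oddSeries a α β x| ≤ max (|L| + 1) K := fun x hx => by
    rcases le_total N x with h | h
    · exact (hN x h).trans (le_max_left _ _)
    · exact (hK x ⟨hx, h⟩).trans (le_max_right _ _)
  refine ⟨max (|L| + 1) K, fun x => ?_⟩
  rcases le_total 0 x with h | h
  · exact hpos x h
  · have := hpos (-x) (by linarith)
    rwa [oddSeries_neg, abs_neg] at this

lemma mul_mittagLeffler_neg_sq (x : ℝ) :
    x * mittagLeffler α β (-x ^ 2) = oddSeries altCoeff α β x := by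
  rw [mittagLeffler, oddSeries, ← tsum_mul_left]
  refine tsum_congr fun r => ?_
  rw [altCoeff, neg_pow, ← pow_mul, pow_succ]; ring

lemma continuous_mittagLeffler_neg_sq (hα : 0 < α) (hβ : 0 < β) :
    Continuous fun x : ℝ => mittagLeffler α β (-x ^ 2) := by
  rw [continuous_iff_continuousAt]
  intro y₀
  have hc : ContinuousOn (fun x : ℝ => mittagLeffler α β (-x ^ 2))
      (Metric.ball 0 (|y₀| + 1)) := by
    refine continuousOn_tsum (fun r => by fun_prop)
      (summable_pow_div_Gamma hα hβ ((|y₀| + 1) ^ 2)) fun r y hy => ?_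
    have hG := Real.Gamma_pos_of_pos (gammaArg_pos hα hβ r)
    rw [mem_ball_zero_iff] at hy
    rw [norm_div, norm_pow, Real.norm_of_nonneg hG.le, norm_neg, norm_pow]
    gcongr
  exact hc.continuousAt (Metric.isOpen_ball.mem_nhds (by simp))

lemma integral_mittagLeffler_neg_sq (hα : 0 < α) (hβ : 0 < β) (b : ℝ) :
    ∫ x in (0 : ℝ)..b, mittagLeffler α β (-x ^ 2) = oddSeries intCoeff α β b := by
  have h := intervalIntegral.hasSum_integral_of_dominated_convergence (μ := volume)
    (a := 0) (b := b) (F := fun (r : ℕ) (x : ℝ) => (-x ^ 2) ^ r / Real.Gamma (α * r + β))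
    (f := fun x => mittagLeffler α β (-x ^ 2))
    (fun (r : ℕ) (_ : ℝ) => (b ^ 2) ^ r / Real.Gamma (α * r + β))
    (fun r => (by fun_prop : Continuous _).aestronglyMeasurable)
    (fun r => .of_forall fun x hx => by
      have hG := Real.Gamma_pos_of_pos (gammaArg_pos hα hβ r)
      have hxb : x ^ 2 ≤ b ^ 2 := by
        rw [mem_uIoc] at hx
        rcases hx with hx | hx <;> nlinarith [hx.1, hx.2]
      rw [norm_div, norm_pow, Real.norm_of_nonneg hG.le, norm_neg, norm_pow, Real.norm_eq_abs,
        sq_abs]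
      gcongr)
    (.of_forall fun x _ => summable_pow_div_Gamma hα hβ (b ^ 2))
    intervalIntegrable_const
    (.of_forall fun x _ => (summable_pow_div_Gamma hα hβ (-x ^ 2)).hasSum)
  rw [← h.tsum_eq, oddSeries]
  refine tsum_congr fun r => ?_
  have : ∀ x : ℝ, (-x ^ 2) ^ r = (-1) ^ r * x ^ (2 * r) := fun x => by rw [neg_pow, ← pow_mul]
  simp_rw [this, mul_div_assoc]
  rw [intervalIntegral.integral_const_mul, intervalIntegral.integral_div, integral_pow, intCoeff]
  push_cast
  simp
  ring

/-- As `E (-x ^ 2)` is even, its improper integral over the line is twice that over `(0, ∞)`. -/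
lemma hasImproperIntegral_iff_tendsto (hα : 0 < α) (hβ : 0 < β) (I : ℝ) :
    HasImproperIntegral (fun x => mittagLeffler α β (-x ^ 2)) I ↔
      Tendsto (oddSeries intCoeff α β) atTop (𝓝 (I / 2)) := by
  have hint : ∀ a b : ℝ, IntervalIntegrable (fun x => mittagLeffler α β (-x ^ 2)) volume a b :=
    fun a b => (continuous_mittagLeffler_neg_sq hα hβ).intervalIntegrable a b
  have hval : ∀ a b : ℝ, ∫ x in a..b, mittagLeffler α β (-x ^ 2) =
      oddSeries intCoeff α β b + oddSeries intCoeff α β (-a) := fun a b => by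
    rw [← intervalIntegral.integral_interval_sub_left (hint 0 b) (hint 0 a),
      integral_mittagLeffler_neg_sq hα hβ, integral_mittagLeffler_neg_sq hα hβ, oddSeries_neg,
      sub_eq_add_neg]
  simp only [HasImproperIntegral, hint, implies_true, true_and, hval]
  constructor
  · intro h
    have h2 := h.comp (tendsto_neg_atTop_atBot.prodMk (tendsto_id (x := (atTop : Filter ℝ))))
    refine (h2.div_const 2).congr fun b => ?_
    simp
  · intro h
    have h1 := h.comp (tendsto_snd (f := (atBot : Filter ℝ)) (g := (atTop : Filter ℝ)))
    have h2 := (h.comp tendsto_neg_atBot_atTop).comp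
      (tendsto_fst (f := (atBot : Filter ℝ)) (g := (atTop : Filter ℝ)))
    simpa using h1.add h2

/-- The identity `Γ(s + 1) = s Γ(s)` relates the primitive for `β` to the one for `β + 1`; it is
integration by parts of `E_{α,β}(z) = β E_{α,β+1}(z) + α z E'_{α,β+1}(z)` at `z = -x²`. -/
lemma oddSeries_intCoeff_eq (hα : 0 < α) (hβ : 0 < β) (x : ℝ) :
    oddSeries intCoeff α β x = (β - α / 2) * oddSeries intCoeff α (β + 1) x +
      α / 2 * oddSeries altCoeff α (β + 1) x := by
  have hβ' : 0 < β + 1 := by linarith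
  rw [oddSeries, oddSeries, oddSeries, ← tsum_mul_left, ← tsum_mul_left,
    ← ((summable_oddSeries hα hβ' abs_intCoeff_le x).mul_left _).tsum_add
      ((summable_oddSeries hα hβ' abs_altCoeff_le x).mul_left _)]
  refine tsum_congr fun r => ?_
  have hs := gammaArg_pos hα hβ r
  have hG := Real.Gamma_pos_of_pos hs
  have h21 : (2 * r + 1 : ℝ) ≠ 0 := by positivity
  rw [← add_assoc, Real.Gamma_add_one hs.ne', intCoeff, altCoeff]
  field_simp
  ring

/-! ### Divergence for `α > 2` -/

/-- The holomorphic extension of `oddSeries intCoeff α β`. -/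
noncomputable def complexPrimitive (α β : ℝ) (z : ℂ) : ℂ :=
  ∑' r : ℕ, ((intCoeff r / Real.Gamma (α * r + β) : ℝ) : ℂ) * z ^ (2 * r + 1)

lemma norm_complexPrimitive_term_le (hα : 0 < α) (hβ : 0 < β) {z : ℂ} {R : ℝ} (hz : ‖z‖ ≤ R)
    (r : ℕ) : ‖((intCoeff r / Real.Gamma (α * r + β) : ℝ) : ℂ) * z ^ (2 * r + 1)‖ ≤
      R * ((R ^ 2) ^ r / Real.Gamma (α * r + β)) := by
  have hR : |R| = R := abs_of_nonneg ((norm_nonneg z).trans hz)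
  refine le_trans ?_ (norm_oddSeries_term_le hα hβ abs_intCoeff_le hR.le r)
  rw [norm_mul, norm_pow, Complex.norm_real, mul_div_right_comm, norm_mul _ (R ^ _), norm_pow R,
    Real.norm_eq_abs R, hR]
  gcongr

lemma differentiable_complexPrimitive (hα : 0 < α) (hβ : 0 < β) :
    Differentiable ℂ (complexPrimitive α β) := by
  intro z₀
  have hd : DifferentiableOn ℂ (complexPrimitive α β) (Metric.ball 0 (‖z₀‖ + 1)) := by
    refine Complex.differentiableOn_tsum_of_summable_norm
      ((summable_pow_div_Gamma hα hβ ((‖z₀‖ + 1) ^ 2)).mul_left (‖z₀‖ + 1))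
      (fun r => by fun_prop) Metric.isOpen_ball fun r z hz => ?_
    rw [mem_ball_zero_iff] at hz
    exact norm_complexPrimitive_term_le hα hβ hz.le r
  exact hd.differentiableAt (Metric.isOpen_ball.mem_nhds (by simp))

lemma complexPrimitive_ofReal (x : ℝ) :
    complexPrimitive α β x = (oddSeries intCoeff α β x : ℂ) := by
  rw [complexPrimitive, oddSeries, Complex.ofReal_tsum]
  refine tsum_congr fun r => ?_
  push_cast; ring

lemma complexPrimitive_neg (z : ℂ) :
    complexPrimitive α β (-z) = -complexPrimitive α β z := by
  rw [complexPrimitive, complexPrimitive, ← tsum_neg]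
  refine tsum_congr fun r => ?_
  rw [Odd.neg_pow ⟨r, rfl⟩]; ring

lemma norm_complexPrimitive_le (hα : 0 < α) (hβ : 0 < β) (z : ℂ) :
    ‖complexPrimitive α β z‖ ≤ ‖z‖ * ∑' r : ℕ, (‖z‖ ^ 2) ^ r / Real.Gamma (α * r + β) := by
  rw [← tsum_mul_left]
  exact tsum_of_norm_bounded ((summable_pow_div_Gamma hα hβ _).mul_left _).hasSum
    (norm_complexPrimitive_term_le hα hβ le_rfl)

/-- A bounded real restriction forces boundedness on the whole plane when `α > 2`: the order `2 / α`
of the function is then less than `1`, so that the Phragmén-Lindelöf principle applies in a half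
plane. The half plane is parametrized by squaring a quadrant. -/
lemma norm_complexPrimitive_le_of_bounded (hα : 2 < α) (hβ : 0 < β) {M : ℝ}
    (hM : ∀ x : ℝ, ‖complexPrimitive α β x‖ ≤ M) (z : ℂ) : ‖complexPrimitive α β z‖ ≤ M := by
  have hα0 : 0 < α := by linarith
  have hd := differentiable_complexPrimitive hα0 hβ
  have hquad : ∀ w : ℂ, 0 ≤ w.re → 0 ≤ w.im → ‖complexPrimitive α β (w ^ 2)‖ ≤ M := by
    intro w hre him
    have hdiff : Differentiable ℂ fun w : ℂ => complexPrimitive α β (w ^ 2) :=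
      hd.comp (differentiable_pow 2)
    refine PhragmenLindelof.quadrant_I (f := fun w : ℂ => complexPrimitive α β (w ^ 2))
      hdiff.diffContOnCl ⟨max 1 (4 / α), ?_, 2 + 2 ^ (1 / α), ?_⟩ ?_ ?_ hre him
    · rw [max_lt_iff, div_lt_iff₀ hα0]
      exact ⟨by norm_num, by linarith⟩
    · obtain ⟨C, hC⟩ := exists_tsum_pow_div_Gamma_le hα0 hβ
      refine Asymptotics.IsBigO.of_bound |C| ?_
      have hev : ∀ᶠ w : ℂ in Bornology.cobounded ℂ, 1 ≤ ‖w‖ :=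
        tendsto_norm_cobounded_atTop.eventually_ge_atTop 1
      filter_upwards [hev.filter_mono inf_le_left] with w hw
      set c := max 1 (4 / α) with hc
      have hwsq : 1 ≤ (‖w‖ ^ 2) ^ 2 := one_le_pow₀ (one_le_pow₀ hw)
      have hpow : ((‖w‖ ^ 2) ^ 2) ^ (1 / α) ≤ ‖w‖ ^ c := by
        rw [← pow_mul, ← Real.rpow_natCast, ← Real.rpow_mul (by positivity)]
        refine Real.rpow_le_rpow_of_exponent_le hw (le_trans (le_of_eq ?_) (le_max_right _ _))
        norm_num; ring
      have hlin : ‖w‖ ^ 2 ≤ Real.exp (2 * ‖w‖ ^ c) := by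
        have h1 : ‖w‖ ≤ Real.exp (‖w‖ ^ c) := by
          have : ‖w‖ ≤ ‖w‖ ^ c := Real.self_le_rpow_of_one_le hw (le_max_left _ _)
          linarith [Real.add_one_le_exp (‖w‖ ^ c)]
        calc ‖w‖ ^ 2 ≤ Real.exp (‖w‖ ^ c) ^ 2 := by gcongr
          _ = _ := by rw [← Real.exp_nat_mul]; norm_num
      rw [Real.norm_of_nonneg (Real.exp_pos _).le]
      calc ‖complexPrimitive α β (w ^ 2)‖
          ≤ ‖w ^ 2‖ * ∑' r : ℕ, (‖w ^ 2‖ ^ 2) ^ r / Real.Gamma (α * r + β) :=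
            norm_complexPrimitive_le hα0 hβ _
        _ ≤ Real.exp (2 * ‖w‖ ^ c) * (|C| * Real.exp (2 ^ (1 / α) * ‖w‖ ^ c)) := by
            rw [norm_pow]
            refine mul_le_mul hlin ((hC _ hwsq).trans ?_) (tsum_nonneg fun r => ?_) (by positivity)
            · rw [Real.mul_rpow (by norm_num) (by positivity)]
              gcongr
              exact le_abs_self C
            · have hG := Real.Gamma_pos_of_pos (gammaArg_pos hα0 hβ r)
              positivity
        _ = _ := by rw [mul_left_comm, ← Real.exp_add, ← add_mul]
    · intro x _
      have hx : (x : ℂ) ^ 2 = ((x ^ 2 : ℝ) : ℂ) := by push_cast; rfl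
      show ‖complexPrimitive α β ((x : ℂ) ^ 2)‖ ≤ M
      rw [hx]
      exact hM _
    · intro x _
      have hI : (x * Complex.I) ^ 2 = ((-(x ^ 2) : ℝ) : ℂ) := by
        push_cast
        rw [mul_pow, Complex.I_sq]; ring
      show ‖complexPrimitive α β ((x * Complex.I) ^ 2)‖ ≤ M
      rw [hI]
      exact hM _
  have hupper : ∀ w : ℂ, 0 ≤ w.im → ‖complexPrimitive α β w‖ ≤ M := by
    intro w hw
    -- a square root of `w` in the closed first quadrant
    rcases eq_or_ne w 0 with rfl | hw0
    · simpa using hM 0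
    have hsq : Complex.exp (Complex.log w / 2) ^ 2 = w := by
      rw [← Complex.exp_nat_mul]
      push_cast
      rw [mul_div_cancel₀ _ two_ne_zero, Complex.exp_log hw0]
    have him : (Complex.log w / 2).im = w.arg / 2 := by
      rw [Complex.div_ofNat_im, Complex.log_im]
    have harg := Complex.arg_nonneg_iff.mpr hw
    have harg' := Complex.arg_le_pi w
    rw [← hsq]
    refine hquad _ ?_ ?_
    · rw [Complex.exp_re, him]
      exact mul_nonneg (Real.exp_pos _).le
        (Real.cos_nonneg_of_neg_pi_div_two_le_of_le (by linarith [Real.pi_pos]) (by linarith))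
    · rw [Complex.exp_im, him]
      exact mul_nonneg (Real.exp_pos _).le
        (Real.sin_nonneg_of_nonneg_of_le_pi (by linarith) (by linarith [Real.pi_pos]))
  rcases le_total 0 z.im with hz | hz
  · exact hupper z hz
  · have := hupper (-z) (by simpa using hz)
    rwa [complexPrimitive_neg, norm_neg] at this

lemma not_tendsto_oddSeries_of_two_lt (hα : 2 < α) (hβ : 0 < β) (L : ℝ) :
    ¬ Tendsto (oddSeries intCoeff α β) atTop (𝓝 L) := by
  intro hL
  have hα0 : 0 < α := by linarith
  obtain ⟨M, hM⟩ := exists_abs_oddSeries_le hα0 hβ abs_intCoeff_le hL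
  have hbd : ∀ z : ℂ, ‖complexPrimitive α β z‖ ≤ M :=
    norm_complexPrimitive_le_of_bounded hα hβ fun x => by
      rw [complexPrimitive_ofReal, Complex.norm_real]; exact hM x
  have hzero : ∀ x : ℝ, oddSeries intCoeff α β x = 0 := fun x => by
    have h := (differentiable_complexPrimitive hα0 hβ).apply_eq_apply_of_bounded
      (isBounded_iff_forall_norm_le.mpr ⟨M, by rintro _ ⟨z, rfl⟩; exact hbd z⟩) x (-x)
    rw [complexPrimitive_neg, complexPrimitive_ofReal] at h
    have h' : oddSeries intCoeff α β x = -oddSeries intCoeff α β x := by exact_mod_cast h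
    linarith
  -- the derivative at the origin is `1 / Γ(β)`, which does not vanish
  have hder := intervalIntegral.integral_hasDerivAt_right
    ((continuous_mittagLeffler_neg_sq hα0 hβ).intervalIntegrable 0 0)
    ((continuous_mittagLeffler_neg_sq hα0 hβ).stronglyMeasurableAtFilter _ _)
    (continuous_mittagLeffler_neg_sq hα0 hβ).continuousAt
  simp_rw [integral_mittagLeffler_neg_sq hα0 hβ, hzero] at hder
  have h0 := hder.unique (hasDerivAt_const (0 : ℝ) (0 : ℝ))
  have hE : mittagLeffler α β (-0 ^ 2) = 1 / Real.Gamma β := by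
    rw [mittagLeffler, tsum_eq_single 0 fun r hr => by simp [hr]]
    simp
  rw [hE] at h0
  have := Real.Gamma_pos_of_pos hβ
  exact (one_div_pos.mpr this).ne' h0

/-! ### The case `α = 2` -/

lemma integrableOn_beta {p q : ℝ} (hp : 0 < p) (hq : 0 < q) :
    IntegrableOn (fun u : ℝ => u ^ (p - 1) * (1 - u) ^ (q - 1)) (Ioo 0 1) := by
  have h := Complex.betaIntegral_convergent (u := p) (v := q) (by simpa) (by simpa)
  rw [intervalIntegrable_iff_integrableOn_Ioo_of_le zero_le_one] at h
  refine h.re.congr ?_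
  filter_upwards [ae_restrict_mem measurableSet_Ioo] with u hu
  have h1 : (0 : ℝ) ≤ 1 - u := by linarith [hu.2]
  have : ((u : ℂ) ^ ((p : ℂ) - 1) * (1 - (u : ℂ)) ^ ((q : ℂ) - 1)) =
      ((u ^ (p - 1) * (1 - u) ^ (q - 1) : ℝ) : ℂ) := by
    push_cast [Complex.ofReal_cpow hu.1.le, Complex.ofReal_cpow h1]
    rfl
  rw [this]
  rfl

lemma integral_beta {p q : ℝ} (hp : 0 < p) (hq : 0 < q) :
    ∫ u in Ioo (0 : ℝ) 1, u ^ (p - 1) * (1 - u) ^ (q - 1) =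
      Real.Gamma p * Real.Gamma q / Real.Gamma (p + q) := by
  have h := Complex.betaIntegral_eq_Gamma_mul_div p q (by simpa) (by simpa)
  rw [Complex.betaIntegral, intervalIntegral.integral_of_le zero_le_one,
    integral_Ioc_eq_integral_Ioo] at h
  have h2 : ∫ u in Ioo (0 : ℝ) 1, (u : ℂ) ^ ((p : ℂ) - 1) * (1 - (u : ℂ)) ^ ((q : ℂ) - 1) =
      ((∫ u in Ioo (0 : ℝ) 1, u ^ (p - 1) * (1 - u) ^ (q - 1) : ℝ) : ℂ) := by
    rw [← integral_complex_ofReal]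
    refine setIntegral_congr_fun measurableSet_Ioo fun u hu => ?_
    have h1 : (0 : ℝ) ≤ 1 - u := by linarith [hu.2]
    push_cast [Complex.ofReal_cpow hu.1.le, Complex.ofReal_cpow h1]
    rfl
  rw [h2, ← Complex.ofReal_add, Complex.Gamma_ofReal, Complex.Gamma_ofReal,
    Complex.Gamma_ofReal] at h
  exact_mod_cast h

/-- Fractional integration of order `q` raises the second parameter of an odd series by `q`. -/
lemma integral_mul_oddSeries {p q : ℝ} (hp : 0 < p) (hq : 0 < q) {a : ℕ → ℝ}
    (ha : ∀ r, |a r| ≤ 1) (b : ℝ) :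
    ∫ u in Ioo (0 : ℝ) 1, u ^ (p - 2) * (1 - u) ^ (q - 1) * oddSeries a 2 p (b * u) =
      Real.Gamma q * oddSeries a 2 (p + q) b := by
  have hGq := Real.Gamma_pos_of_pos hq
  set F : ℕ → ℝ → ℝ := fun r u => a r * b ^ (2 * r + 1) / Real.Gamma (2 * r + p) *
    (u ^ ((2 * r + p) - 1) * (1 - u) ^ (q - 1)) with hF
  have hpr : ∀ r : ℕ, 0 < 2 * (r : ℝ) + p := fun r => gammaArg_pos two_pos hp r
  have hint : ∀ r, IntegrableOn (F r) (Ioo 0 1) := fun r =>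
    (integrableOn_beta (hpr r) hq).const_mul _
  have hval : ∀ r : ℕ, ∫ u in Ioo (0 : ℝ) 1, u ^ ((2 * (r : ℝ) + p) - 1) * (1 - u) ^ (q - 1) =
      Real.Gamma (2 * r + p) * Real.Gamma q / Real.Gamma (2 * r + (p + q)) := fun r => by
    rw [integral_beta (hpr r) hq, add_assoc]
  have hsum : ∀ u ∈ Ioo (0 : ℝ) 1,
      u ^ (p - 2) * (1 - u) ^ (q - 1) * oddSeries a 2 p (b * u) = ∑' r, F r u := by
    intro u hu
    rw [oddSeries, ← tsum_mul_left]
    refine tsum_congr fun r => ?_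
    have : u ^ ((2 * (r : ℝ) + p) - 1) = u ^ (p - 2) * u ^ (2 * r + 1) := by
      rw [← Real.rpow_natCast, ← Real.rpow_add hu.1]
      congr 1; push_cast; ring
    simp only [hF]
    rw [this, mul_pow]; ring
  rw [setIntegral_congr_fun measurableSet_Ioo hsum, ← integral_tsum_of_summable_integral_norm hint,
    oddSeries, ← tsum_mul_left]
  · refine tsum_congr fun r => ?_
    have := (Real.Gamma_pos_of_pos (hpr r)).ne'
    simp only [hF]
    rw [integral_const_mul, hval]
    field_simp
  · refine ((summable_oddSeries two_pos (add_pos hp hq) ha b).norm.mul_left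
      (Real.Gamma q)).congr fun r => ?_
    have hG := Real.Gamma_pos_of_pos (hpr r)
    have hG' := Real.Gamma_pos_of_pos (gammaArg_pos two_pos (add_pos hp hq) r)
    have hpos : ∀ u ∈ Ioo (0 : ℝ) 1, ‖F r u‖ = ‖a r * b ^ (2 * r + 1)‖ / Real.Gamma (2 * r + p) *
        (u ^ ((2 * r + p) - 1) * (1 - u) ^ (q - 1)) := fun u hu => by
      have h0 := hu.1
      have h1 : (0 : ℝ) < 1 - u := by linarith [hu.2]
      simp only [hF]
      rw [norm_mul, norm_div, Real.norm_of_nonneg hG.le,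
        Real.norm_of_nonneg (r := u ^ ((2 * r + p) - 1) * (1 - u) ^ (q - 1)) (by positivity)]
    rw [setIntegral_congr_fun measurableSet_Ioo hpos, integral_const_mul, hval, norm_div,
      Real.norm_of_nonneg hG'.le]
    field_simp

/-- Averaging the dilates of a convergent odd series against an integrable weight. -/
lemma tendsto_integral_mul_oddSeries {p : ℝ} (hp : 0 < p) {a : ℕ → ℝ}
    (ha : ∀ r, |a r| ≤ 1) {L : ℝ} (hL : Tendsto (oddSeries a 2 p) atTop (𝓝 L)) {w : ℝ → ℝ}
    (hw : IntegrableOn w (Ioo 0 1)) :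
    Tendsto (fun b : ℝ => ∫ u in Ioo (0 : ℝ) 1, w u * oddSeries a 2 p (b * u)) atTop
      (𝓝 (∫ u in Ioo (0 : ℝ) 1, w u * L)) := by
  obtain ⟨M, hM⟩ := exists_abs_oddSeries_le two_pos hp ha hL
  have hcont := continuous_oddSeries two_pos hp ha
  refine tendsto_integral_filter_of_dominated_convergence (fun u => ‖w u‖ * M)
    (.of_forall fun b => ?_) (.of_forall fun b => .of_forall fun u => ?_) (hw.norm.mul_const M) ?_
  · exact hw.aestronglyMeasurable.mul
      (hcont.comp (continuous_const_mul b)).aestronglyMeasurable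
  · rw [norm_mul]
    gcongr
    exact hM _
  · filter_upwards [ae_restrict_mem measurableSet_Ioo] with u hu
    exact (hL.comp (tendsto_id.atTop_mul_const hu.1)).const_mul (w u)

lemma oddSeries_altCoeff_two_two (x : ℝ) : oddSeries altCoeff 2 2 x = Real.sin x := by
  rw [← (Real.hasSum_sin x).tsum_eq, oddSeries]
  refine tsum_congr fun r => ?_
  rw [altCoeff, ← Real.Gamma_nat_eq_factorial]
  push_cast
  ring_nf

lemma not_tendsto_sin_atTop (L : ℝ) : ¬ Tendsto Real.sin atTop (𝓝 L) := by
  intro h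
  have hn : Tendsto (fun n : ℕ => (n : ℝ) * (2 * Real.pi)) atTop atTop :=
    tendsto_natCast_atTop_atTop.atTop_mul_const (by positivity)
  have h0 : L = 0 := tendsto_nhds_unique (h.comp hn) <| by
    refine tendsto_const_nhds.congr fun n => ?_
    have := Real.sin_add_nat_mul_two_pi 0 n
    simpa using this.symm
  have h1 : L = 1 := tendsto_nhds_unique
      (h.comp (tendsto_atTop_add_const_left _ (Real.pi / 2) hn)) <| by
    refine tendsto_const_nhds.congr fun n => ?_
    have := Real.sin_add_nat_mul_two_pi (Real.pi / 2) n
    rw [Function.comp_apply, this, Real.sin_pi_div_two]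
  linarith

open Real FourierTransform in
/-- The Riemann-Lebesgue lemma for sine integrals over the unit interval. -/
lemma tendsto_integral_mul_sin {w : ℝ → ℝ} (hw : IntegrableOn w (Ioo 0 1)) :
    Tendsto (fun b : ℝ => ∫ u in Ioo (0 : ℝ) 1, w u * sin (b * u)) atTop (𝓝 0) := by
  have hRL := (Real.tendsto_integral_exp_smul_cocompact
    ((Ioo (0 : ℝ) 1).indicator fun u => (w u : ℂ))).mono_left atTop_le_cocompact
  have hdiv : Tendsto (fun b : ℝ => b / (2 * π)) atTop atTop :=
    tendsto_id.atTop_div_const (by positivity)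
  have him := (Complex.continuous_im.tendsto _).comp (hRL.comp hdiv)
  rw [Complex.zero_im] at him
  have hneg := him.neg
  rw [neg_zero] at hneg
  refine hneg.congr fun b => ?_
  have hint : IntegrableOn (fun u => Complex.exp ((-(b * u) : ℝ) * Complex.I) * (w u : ℂ))
      (Ioo 0 1) := by
    refine hw.ofReal.bdd_mul (c := 1) ?_
      (.of_forall fun u => (Complex.norm_exp_ofReal_mul_I _).le)
    exact (by fun_prop : Continuous _).aestronglyMeasurable
  have hind : ∀ u : ℝ, 𝐞 (-(u * (b / (2 * π)))) • (Ioo (0 : ℝ) 1).indicator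
      (fun u => (w u : ℂ)) u = (Ioo (0 : ℝ) 1).indicator
      (fun u => Complex.exp ((-(b * u) : ℝ) * Complex.I) * (w u : ℂ)) u := fun u => by
    have harg : 2 * π * -(u * (b / (2 * π))) = -(b * u) := by field_simp
    rw [Circle.smul_def, smul_eq_mul, Real.fourierChar_apply, harg]
    by_cases hu : u ∈ Ioo (0 : ℝ) 1
    · rw [indicator_of_mem hu, indicator_of_mem hu]
    · rw [indicator_of_notMem hu, indicator_of_notMem hu, mul_zero]
  simp only [Function.comp_apply, hind, integral_indicator measurableSet_Ioo]
  have him' := integral_im hint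
  rw [RCLike.im_to_complex] at him'
  rw [← him', ← integral_neg]
  refine setIntegral_congr_fun measurableSet_Ioo fun u _ => ?_
  simp only [RCLike.im_to_complex, Complex.im_mul_ofReal, Complex.exp_ofReal_mul_I_im, sin_neg]
  ring

open Real in
lemma integral_exp_neg_mul_sin (t b : ℝ) :
    ∫ x in (0 : ℝ)..b, exp (-(t * x)) * sin x =
      (1 + t ^ 2)⁻¹ - exp (-(t * b)) * (cos b + t * sin b) / (1 + t ^ 2) := by
  have h0 : (1 + t ^ 2) ≠ 0 := by positivity
  have hder : ∀ x ∈ uIcc 0 b, HasDerivAt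
      (fun x => -(exp (-(t * x)) * (cos x + t * sin x) / (1 + t ^ 2)))
      (exp (-(t * x)) * sin x) x := by
    intro x _
    have h1 : HasDerivAt (fun x => exp (-(t * x))) (exp (-(t * x)) * (-(t * 1))) x :=
      ((hasDerivAt_id x).const_mul t).neg.exp
    have h2 : HasDerivAt (fun x => cos x + t * sin x) (-sin x + t * cos x) x :=
      (hasDerivAt_cos x).add ((hasDerivAt_sin x).const_mul t)
    refine ((h1.mul h2).div_const (1 + t ^ 2)).neg.congr_deriv ?_
    field_simp
    ring
  rw [intervalIntegral.integral_eq_sub_of_hasDerivAt hder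
    ((by fun_prop : Continuous _).intervalIntegrable _ _)]
  simp
  ring

open Real in
/-- The Dirichlet integral, evaluated by writing `1 / x = ∫ e^{-t x} dt`. -/
lemma tendsto_oddSeries_intCoeff_two_two :
    Tendsto (oddSeries intCoeff 2 2) atTop (𝓝 (π / 2)) := by
  have hF : ∀ x : ℝ, 0 < x → mittagLeffler 2 2 (-x ^ 2) = sin x / x := fun x hx => by
    rw [eq_div_iff hx.ne', mul_comm, mul_mittagLeffler_neg_sq, oddSeries_altCoeff_two_two]
  have hexp : ∀ x : ℝ, 0 < x → IntegrableOn (fun t : ℝ => exp (-(t * x))) (Ioi 0) := fun x hx => by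
    refine (integrableOn_exp_mul_Ioi (neg_neg_of_pos hx) 0).congr_fun (fun t _ => ?_)
      measurableSet_Ioi
    simp only; congr 1; ring
  have hexpval : ∀ x : ℝ, 0 < x → ∫ t in Ioi (0 : ℝ), exp (-(t * x)) = x⁻¹ := fun x hx => by
    have := integral_exp_mul_Ioi (neg_neg_of_pos hx) 0
    simp only [mul_zero, exp_zero] at this
    rw [neg_div_neg_eq, one_div] at this
    rw [← this]
    congr 1; ext t; congr 1; ring
  have hkey : ∀ b : ℝ, 0 < b → ‖oddSeries intCoeff 2 2 b - π / 2‖ ≤ 2 * b⁻¹ := by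
    intro b hb
    have hprod : Integrable (Function.uncurry fun x t : ℝ => exp (-(t * x)) * sin x)
        ((volume.restrict (Ioc 0 b)).prod (volume.restrict (Ioi 0))) := by
      rw [integrable_prod_iff (by
        exact (by fun_prop : Continuous (Function.uncurry fun x t : ℝ =>
          exp (-(t * x)) * sin x)).aestronglyMeasurable)]
      refine ⟨?_, ?_⟩
      · filter_upwards [ae_restrict_mem measurableSet_Ioc] with x hx
        exact (hexp x hx.1).mul_const (sin x)
      · have hone : IntegrableOn (fun x : ℝ => (1 : ℝ)) (Ioc 0 b) := by simp
        refine hone.mono' ?_ ?_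
        · exact (by fun_prop : Continuous (Function.uncurry fun x t : ℝ =>
            exp (-(t * x)) * sin x)).norm.aestronglyMeasurable.integral_prod_right'
        · filter_upwards [ae_restrict_mem measurableSet_Ioc] with x hx
          have : ∀ t : ℝ, ‖Function.uncurry (fun x t : ℝ => exp (-(t * x)) * sin x) (x, t)‖ =
              exp (-(t * x)) * |sin x| := fun t => by
            simp [Function.uncurry]
          simp_rw [this]
          rw [integral_mul_const, hexpval x hx.1, Real.norm_of_nonneg
            (mul_nonneg (inv_nonneg.mpr hx.1.le) (abs_nonneg _)), inv_mul_le_iff₀ hx.1, mul_one]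
          have := abs_sin_le_abs (x := x)
          rwa [abs_of_pos hx.1] at this
    have hswap := integral_integral_swap hprod
    have hleft : ∫ x in Ioc 0 b, ∫ t in Ioi (0 : ℝ), exp (-(t * x)) * sin x =
        oddSeries intCoeff 2 2 b := by
      rw [← integral_mittagLeffler_neg_sq two_pos two_pos,
        intervalIntegral.integral_of_le hb.le]
      refine setIntegral_congr_fun measurableSet_Ioc fun x hx => ?_
      rw [integral_mul_const, hexpval x hx.1, hF x hx.1]; ring
    have hright : ∀ t : ℝ, ∫ x in Ioc 0 b, exp (-(t * x)) * sin x =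
        (1 + t ^ 2)⁻¹ - exp (-(t * b)) * (cos b + t * sin b) / (1 + t ^ 2) := fun t => by
      rw [← intervalIntegral.integral_of_le hb.le, integral_exp_neg_mul_sin]
    have hrem : ∀ t ∈ Ioi (0 : ℝ),
        ‖exp (-(t * b)) * (cos b + t * sin b) / (1 + t ^ 2)‖ ≤ 2 * exp (-(t * b)) := by
      intro t ht
      have ht' : (0 : ℝ) < t := ht
      have hnum : |cos b + t * sin b| ≤ 1 + t := by
        refine (abs_add_le _ _).trans ?_
        rw [abs_mul, abs_of_pos ht']
        nlinarith [abs_cos_le_one b, abs_sin_le_one b]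
      rw [norm_div, norm_mul, Real.norm_of_nonneg (exp_pos _).le,
        Real.norm_of_nonneg (r := 1 + t ^ 2) (by positivity), Real.norm_eq_abs,
        div_le_iff₀ (by positivity)]
      have h2 : 1 + t ≤ 2 * (1 + t ^ 2) := by nlinarith [sq_nonneg (t - 1 / 2)]
      calc exp (-(t * b)) * |cos b + t * sin b| ≤ exp (-(t * b)) * (2 * (1 + t ^ 2)) := by
            gcongr; linarith
        _ = _ := by ring
    have hbd : IntegrableOn (fun t : ℝ => 2 * exp (-(t * b))) (Ioi 0) := (hexp b hb).const_mul 2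
    have hremint : IntegrableOn
        (fun t : ℝ => exp (-(t * b)) * (cos b + t * sin b) / (1 + t ^ 2)) (Ioi 0) := by
      refine hbd.mono' ?_ ((ae_restrict_mem measurableSet_Ioi).mono hrem)
      refine Continuous.aestronglyMeasurable (Continuous.div (by fun_prop) (by fun_prop) ?_)
      intro t; positivity
    rw [hleft] at hswap
    simp_rw [hright] at hswap
    rw [integral_sub integrable_inv_one_add_sq.integrableOn hremint,
      integral_Ioi_inv_one_add_sq, arctan_zero, sub_zero] at hswap
    rw [hswap, sub_sub_cancel_left, norm_neg]
    refine (norm_integral_le_of_norm_le hbd ((ae_restrict_mem measurableSet_Ioi).mono hrem)).trans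
      (le_of_eq ?_)
    rw [integral_const_mul, hexpval b hb]
  rw [tendsto_iff_norm_sub_tendsto_zero]
  refine squeeze_zero' (.of_forall fun _ => norm_nonneg _)
    ((eventually_gt_atTop 0).mono hkey) ?_
  simpa using tendsto_inv_atTop_zero.const_mul (2 : ℝ)

/-- Convergence for `α = 2`, `β > 2`, by fractional integration of the Dirichlet integral. -/
lemma tendsto_oddSeries_intCoeff_of_two_lt (hβ : 2 < β) :
    Tendsto (oddSeries intCoeff 2 β) atTop (𝓝 (Real.pi / 2 / Real.Gamma (β - 1))) := by
  have hq : 0 < β - 2 := by linarith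
  have hGq := Real.Gamma_pos_of_pos hq
  have hw := integrableOn_beta (p := 1) one_pos hq
  have h := tendsto_integral_mul_oddSeries two_pos abs_intCoeff_le
    tendsto_oddSeries_intCoeff_two_two hw
  rw [integral_mul_const, integral_beta one_pos hq, Real.Gamma_one] at h
  have h' := h.const_mul (Real.Gamma (β - 2))⁻¹
  have e1 : (1 : ℝ) + (β - 2) = β - 1 := by ring
  have e2 : (2 : ℝ) + (β - 2) = β := by ring
  rw [e1] at h'
  convert h' using 2
  · rename_i b
    have := integral_mul_oddSeries two_pos hq abs_intCoeff_le b
    rw [e2] at this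
    rw [eq_inv_mul_iff_mul_eq₀ hGq.ne', ← this]
    refine setIntegral_congr_fun measurableSet_Ioo fun u _ => ?_
    norm_num
  · field_simp

/-- For `β > 1` the function `x E_{2,β+1}(-x²)` is a sine integral against the integrable weight
`(1 - u) ^ (β - 2)`, hence vanishes at infinity. -/
lemma tendsto_oddSeries_altCoeff_two (hβ : 1 < β) :
    Tendsto (oddSeries altCoeff 2 (β + 1)) atTop (𝓝 0) := by
  have hq : 0 < β - 1 := by linarith
  have hGq := Real.Gamma_pos_of_pos hq
  have h := (tendsto_integral_mul_sin (integrableOn_beta (p := 1) one_pos hq)).const_mul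
    (Real.Gamma (β - 1))⁻¹
  rw [mul_zero] at h
  refine h.congr fun b => ?_
  have := integral_mul_oddSeries two_pos hq abs_altCoeff_le b
  rw [show (2 : ℝ) + (β - 1) = β + 1 by ring] at this
  rw [inv_mul_eq_iff_eq_mul₀ hGq.ne', ← this]
  refine setIntegral_congr_fun measurableSet_Ioo fun u _ => ?_
  simp only [oddSeries_altCoeff_two_two]
  norm_num

lemma tendsto_oddSeries_intCoeff_two (hβ : 1 < β) :
    Tendsto (oddSeries intCoeff 2 β) atTop (𝓝 (Real.pi / 2 / Real.Gamma (β - 1))) := by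
  have h1 := (tendsto_oddSeries_intCoeff_of_two_lt (β := β + 1) (by linarith)).const_mul (β - 1)
  have h := h1.add (tendsto_oddSeries_altCoeff_two hβ)
  have hG := Real.Gamma_pos_of_pos (show 0 < β - 1 by linarith)
  have hβ1 : β - 1 ≠ 0 := by linarith
  convert h using 2
  · rw [oddSeries_intCoeff_eq two_pos (by linarith)]
    norm_num
  · have := Real.Gamma_add_one hβ1
    rw [add_zero, show β + 1 - 1 = β - 1 + 1 by ring, this]
    field_simp

/-- For `β ≤ 1` convergence would pass, through the recursion in `β` and fractional integration of
order `1 - β`, to the sine function. -/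
lemma not_tendsto_oddSeries_two (hβ : 0 < β) (hβ1 : β ≤ 1) (L : ℝ) :
    ¬ Tendsto (oddSeries intCoeff 2 β) atTop (𝓝 L) := by
  intro hL
  have hrec : ∀ x, oddSeries altCoeff 2 (β + 1) x =
      oddSeries intCoeff 2 β x - (β - 1) * oddSeries intCoeff 2 (β + 1) x := fun x => by
    rw [oddSeries_intCoeff_eq two_pos hβ x]; ring
  have hX : Tendsto (oddSeries altCoeff 2 (β + 1)) atTop
      (𝓝 (L - (β - 1) * (Real.pi / 2 / Real.Gamma (β + 1 - 1)))) := by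
    refine (hL.sub ((tendsto_oddSeries_intCoeff_two (β := β + 1) (by linarith)).const_mul
      (β - 1))).congr fun x => (hrec x).symm
  rcases eq_or_lt_of_le hβ1 with rfl | hlt
  · rw [one_add_one_eq_two, funext oddSeries_altCoeff_two_two] at hX
    exact not_tendsto_sin_atTop _ hX
  · have hq : 0 < 1 - β := by linarith
    have hGq := Real.Gamma_pos_of_pos hq
    have h := (tendsto_integral_mul_oddSeries (by linarith) abs_altCoeff_le hX
      (integrableOn_beta hβ hq)).const_mul (Real.Gamma (1 - β))⁻¹
    refine not_tendsto_sin_atTop _ (h.congr fun b => ?_)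
    have := integral_mul_oddSeries (p := β + 1) (by linarith) hq abs_altCoeff_le b
    rw [show β + 1 + (1 - β) = 2 by ring, oddSeries_altCoeff_two_two] at this
    rw [inv_mul_eq_iff_eq_mul₀ hGq.ne', ← this]
    refine setIntegral_congr_fun measurableSet_Ioo fun u _ => ?_
    rw [show β + 1 - 2 = β - 1 by ring]

/-! ### The Bromwich integral for `1 / Γ` -/

open ProbabilityTheory in
/-- The Laplace transform of `t ^ (s - 1)`, for complex `w`: both sides are holomorphic in the right
half plane and agree on the positive real axis. -/
lemma integral_rpow_mul_cexp_neg_mul {s : ℝ} (hs : 0 < s) {w : ℂ} (hw : 0 < w.re) :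
    ∫ t in Ioi (0 : ℝ), ((t ^ (s - 1) : ℝ) : ℂ) * Complex.exp (-(w * t)) =
      Real.Gamma s * w ^ ((-s : ℝ) : ℂ) := by
  -- the left-hand side is the moment generating function at `-w` of the measure `t ^ (s - 1) dt`
  set μ : Measure ℝ := (volume.restrict (Ioi 0)).withDensity fun t => ENNReal.ofReal (t ^ (s - 1))
    with hμ
  have hmeas : Measurable fun t : ℝ => ENNReal.ofReal (t ^ (s - 1)) := by fun_prop
  have hlt : ∀ᵐ t ∂(volume.restrict (Ioi (0 : ℝ))), ENNReal.ofReal (t ^ (s - 1)) < ⊤ :=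
    .of_forall fun t => ENNReal.ofReal_lt_top
  have hmgf : ∀ z : ℂ, complexMGF id μ z =
      ∫ t in Ioi (0 : ℝ), ((t ^ (s - 1) : ℝ) : ℂ) * Complex.exp (z * t) := by
    intro z
    rw [complexMGF, hμ, integral_withDensity_eq_integral_toReal_smul hmeas hlt]
    refine setIntegral_congr_fun measurableSet_Ioi fun t ht => ?_
    have ht' : (0 : ℝ) < t := ht
    simp only [id]
    rw [ENNReal.toReal_ofReal (by positivity), Complex.real_smul]
  have hset : Iio (0 : ℝ) ⊆ interior (integrableExpSet id μ) := by
    refine isOpen_Iio.subset_interior_iff.mpr fun r hr => ?_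
    have hr' : 0 < -r := by simpa using hr
    have h := integrableOn_rpow_mul_exp_neg_mul_rpow (p := 1) (s := s - 1) (b := -r)
      (by linarith) one_pos hr'
    show Integrable _ μ
    rw [hμ, integrable_withDensity_iff_integrable_smul' hmeas hlt]
    refine IntegrableOn.congr_fun h (fun t ht => ?_) measurableSet_Ioi
    have ht' : (0 : ℝ) < t := ht
    simp only [id, Real.rpow_one, neg_neg]
    rw [ENNReal.toReal_ofReal (by positivity), smul_eq_mul]
  have hopen : IsOpen {z : ℂ | z.re < 0} := isOpen_Iio.preimage Complex.continuous_re
  have hL : AnalyticOnNhd ℂ (complexMGF id μ) {z : ℂ | z.re < 0} :=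
    analyticOnNhd_complexMGF.mono fun z hz => hset hz
  have hR : AnalyticOnNhd ℂ (fun z : ℂ => Real.Gamma s * (-z) ^ ((-s : ℝ) : ℂ))
      {z : ℂ | z.re < 0} := by
    refine DifferentiableOn.analyticOnNhd (fun z hz => ?_) hopen
    refine (DifferentiableAt.const_mul (DifferentiableAt.cpow_const differentiableAt_id.neg
      (Or.inl ?_)) _).differentiableWithinAt
    simpa using hz
  have hconv : IsPreconnected {z : ℂ | z.re < 0} :=
    (convex_halfSpace_re_lt 0).isPreconnected
  have heq := hL.eqOn_of_preconnected_of_frequently_eq hR hconv (z₀ := ((-1 : ℝ) : ℂ))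
    (by simp) ?_
  · have h := heq (show -w ∈ {z : ℂ | z.re < 0} by simpa using hw)
    simp only [hmgf, neg_neg, neg_mul] at h
    exact h
  · have hreal : ∀ᶠ r : ℝ in 𝓝[≠] (-1),
        complexMGF id μ r = Real.Gamma s * (-(r : ℂ)) ^ ((-s : ℝ) : ℂ) := by
      filter_upwards [mem_nhdsWithin_of_mem_nhds (Iio_mem_nhds (show (-1 : ℝ) < 0 by norm_num))]
        with r hr
      have hr' : 0 < -r := by simpa using hr
      have h := Real.integral_rpow_mul_exp_neg_mul_Ioi hs hr'
      rw [hmgf, ← Complex.ofReal_neg, ← Complex.ofReal_cpow hr'.le, ← Complex.ofReal_mul,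
        Real.rpow_neg hr'.le, ← Real.inv_rpow hr'.le, ← one_div, mul_comm, ← h,
        ← integral_complex_ofReal]
      refine setIntegral_congr_fun measurableSet_Ioi fun t _ => ?_
      push_cast
      rw [neg_mul, neg_neg]
    have hmap : Tendsto (fun r : ℝ => (r : ℂ)) (𝓝[≠] (-1)) (𝓝[≠] ((-1 : ℝ) : ℂ)) := by
      refine tendsto_nhdsWithin_of_tendsto_nhds_of_eventually_within _
        ((Complex.continuous_ofReal.tendsto _).mono_left nhdsWithin_le_nhds) ?_
      filter_upwards [self_mem_nhdsWithin] with r hr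
      exact fun h => hr (Complex.ofReal_injective h)
    exact hmap.frequently hreal.frequently

/-- The point `c + 2πξ i` of the vertical line `Re w = c`. The factor `2π` absorbs the normalization
of the Bromwich integral. -/
noncomputable def line (c ξ : ℝ) : ℂ := c + ((2 * Real.pi * ξ : ℝ) : ℂ) * Complex.I

@[simp] lemma line_re (c ξ : ℝ) : (line c ξ).re = c := by simp [line]

@[simp] lemma line_im (c ξ : ℝ) : (line c ξ).im = 2 * Real.pi * ξ := by simp [line]

@[fun_prop] lemma continuous_line (c : ℝ) : Continuous (line c) := by
  unfold line; fun_prop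

lemma one_add_sq_le_norm_line_sq {c : ℝ} (hc : 1 ≤ c) (ξ : ℝ) : 1 + ξ ^ 2 ≤ ‖line c ξ‖ ^ 2 := by
  rw [Complex.sq_norm, Complex.normSq_apply, line_re, line_im]
  have h1 : 1 ≤ (2 * Real.pi) ^ 2 := one_le_pow₀ (by linarith [Real.pi_gt_three])
  nlinarith [sq_nonneg ξ]

lemma one_le_norm_line {c : ℝ} (hc : 1 ≤ c) (ξ : ℝ) : 1 ≤ ‖line c ξ‖ := by
  have h := one_add_sq_le_norm_line_sq hc ξ
  nlinarith [sq_nonneg ξ, norm_nonneg (line c ξ)]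

lemma le_norm_line (c ξ : ℝ) : c ≤ ‖line c ξ‖ := by
  simpa using Complex.re_le_norm (line c ξ)

lemma integrable_norm_line_rpow {c B : ℝ} (hc : 1 ≤ c) (hB : 1 < B) :
    Integrable fun ξ : ℝ => ‖line c ξ‖ ^ (-B) := by
  have h := integrable_rpow_neg_one_add_norm_sq (E := ℝ) (μ := volume) (r := B) (by simpa using hB)
  refine h.mono' ?_ (.of_forall fun ξ => ?_)
  · refine (Continuous.rpow_const (by fun_prop) fun ξ => Or.inl ?_).aestronglyMeasurable
    linarith [one_le_norm_line hc ξ]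
  · rw [Real.norm_of_nonneg (by positivity), Real.norm_eq_abs, sq_abs]
    have h2 : ‖line c ξ‖ ^ (-B) = (‖line c ξ‖ ^ 2) ^ (-B / 2) := by
      rw [← Real.rpow_natCast, ← Real.rpow_mul (norm_nonneg _)]
      congr 1; push_cast; ring
    rw [h2]
    exact Real.rpow_le_rpow_of_nonpos (by positivity) (one_add_sq_le_norm_line_sq hc ξ)
      (by linarith)

lemma continuous_line_cpow {c : ℝ} (hc : 0 < c) (s : ℂ) :
    Continuous fun ξ : ℝ => line c ξ ^ s :=
  (continuous_line c).cpow continuous_const fun ξ => Or.inl (by simpa using hc)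

open FourierTransform in
/-- The Bromwich representation of `1 / Γ`: Fourier inversion of `t ^ (B - 1) e^{-c t}` at
`t = 1`. -/
lemma integral_cexp_mul_cpow_line {c B : ℝ} (hc : 1 ≤ c) (hB : 1 < B) :
    ∫ ξ : ℝ, Complex.exp (line c ξ) * line c ξ ^ ((-B : ℝ) : ℂ) =
      ((Real.Gamma B)⁻¹ : ℝ) := by
  have hc0 : 0 < c := by linarith
  have hB0 : 0 < B := by linarith
  have hG := Real.Gamma_pos_of_pos hB0
  set f : ℝ → ℂ := (Ioi (0 : ℝ)).indicator
    fun t => ((t ^ (B - 1) : ℝ) : ℂ) * Complex.exp (-(c * t)) with hf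
  have hfint : Integrable f := by
    rw [hf, integrable_indicator_iff measurableSet_Ioi]
    have h := integrableOn_rpow_mul_exp_neg_mul_rpow (p := 1) (s := B - 1) (b := c)
      (by linarith) one_pos hc0
    refine IntegrableOn.congr_fun h.ofReal (fun t _ => ?_) measurableSet_Ioi
    simp
  have hfour : ∀ ξ : ℝ, 𝓕 f ξ = Real.Gamma B * line c ξ ^ ((-B : ℝ) : ℂ) := by
    intro ξ
    rw [Real.fourier_real_eq_integral_exp_smul,
      ← integral_rpow_mul_cexp_neg_mul hB0 (show 0 < (line c ξ).re by simpa using hc0),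
      ← integral_indicator measurableSet_Ioi]
    congr 1
    ext t
    by_cases ht : t ∈ Ioi (0 : ℝ)
    · rw [hf, indicator_of_mem ht, indicator_of_mem ht, smul_eq_mul, mul_left_comm,
        ← Complex.exp_add]
      congr 2
      simp only [line]; push_cast; ring
    · rw [hf, indicator_of_notMem ht, indicator_of_notMem ht, smul_zero]
  have hnorm : ∀ ξ : ℝ, ‖line c ξ ^ ((-B : ℝ) : ℂ)‖ = ‖line c ξ‖ ^ (-B) := fun ξ =>
    Complex.norm_cpow_real _ _
  have hFint : Integrable (𝓕 f) := by
    rw [funext hfour]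
    refine Integrable.const_mul ((integrable_norm_line_rpow hc hB).mono' ?_
      (.of_forall fun ξ => (hnorm ξ).le)) _
    exact (continuous_line_cpow hc0 _).aestronglyMeasurable
  have hcont : ContinuousAt f 1 := by
    have hev : (fun t : ℝ => ((t ^ (B - 1) : ℝ) : ℂ) * Complex.exp (-(c * t))) =ᶠ[𝓝 1] f := by
      filter_upwards [Ioi_mem_nhds (show (0 : ℝ) < 1 by norm_num)] with t ht
      rw [hf, indicator_of_mem ht]
    refine ContinuousAt.congr (ContinuousAt.mul ?_ (by fun_prop)) hev
    exact Complex.continuous_ofReal.continuousAt.comp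
      (Real.continuousAt_rpow_const _ _ (Or.inl one_ne_zero))
  have hinv := hfint.fourierInv_fourier_eq hFint hcont
  have hf1 : f 1 = Complex.exp (-c) := by
    rw [hf, indicator_of_mem (by simp)]
    simp
  rw [hf1, Real.fourierInv_eq'] at hinv
  have hpt : ∀ ξ : ℝ, Complex.exp (line c ξ) * line c ξ ^ ((-B : ℝ) : ℂ) =
      (Complex.exp c * (Real.Gamma B : ℂ)⁻¹) *
        (Complex.exp (((2 * Real.pi * inner ℝ ξ 1 : ℝ) : ℂ) * Complex.I) • 𝓕 f ξ) := by
    intro ξ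
    have hGne : (Real.Gamma B : ℂ) ≠ 0 := by exact_mod_cast hG.ne'
    have hin : (inner ℝ ξ 1 : ℝ) = ξ := by simp
    rw [hfour, smul_eq_mul, hin]
    conv_lhs => rw [line, Complex.exp_add]
    rw [← line]
    field_simp
  simp_rw [hpt]
  rw [integral_const_mul, hinv, mul_right_comm, ← Complex.exp_add]
  simp

/-- Moving a vertical line of integration across a region of holomorphy, for integrands decaying
like `‖w‖ ^ (-B)` with `B > 1`. -/
lemma integral_line_eq_integral_line_one {f : ℂ → ℂ} {B M c : ℝ} (hB : 1 < B) (hc : 1 ≤ c)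
    (hf : DifferentiableOn ℂ f {w | 0 < w.re})
    (hM : ∀ w : ℂ, 1 ≤ w.re → w.re ≤ c → ‖f w‖ ≤ M * ‖w‖ ^ (-B)) :
    ∫ ξ : ℝ, f (line c ξ) = ∫ ξ : ℝ, f (line 1 ξ) := by
  have hM0 : 0 ≤ M := by
    have h := (norm_nonneg _).trans (hM 1 (by simp) (by simpa using hc))
    simpa using h
  have hopen : IsOpen {w : ℂ | 0 < w.re} := isOpen_Ioi.preimage Complex.continuous_re
  have hint : ∀ a : ℝ, 1 ≤ a → a ≤ c → Integrable fun ξ : ℝ => f (line a ξ) := by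
    intro a ha hac
    refine ((integrable_norm_line_rpow ha hB).const_mul M).mono' ?_
      (.of_forall fun ξ => hM _ (by simpa using ha) (by simpa using hac))
    refine (hf.continuousOn.comp_continuous (continuous_line a) fun ξ => ?_).aestronglyMeasurable
    show 0 < (line a ξ).re
    rw [line_re]; linarith
  have hpi : (0 : ℝ) < 2 * Real.pi := by positivity
  -- in the unnormalized variable `y = 2πξ`
  have hline : ∀ a ξ : ℝ, line a ξ = a + ((2 * Real.pi * ξ : ℝ) : ℂ) * Complex.I := fun _ _ => rfl
  have hint' : ∀ a : ℝ, 1 ≤ a → a ≤ c → Integrable fun y : ℝ => f (a + y * Complex.I) := by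
    intro a ha hac
    have := hint a ha hac
    simp_rw [hline] at this
    exact (integrable_comp_mul_left_iff (fun y : ℝ => f (a + y * Complex.I)) hpi.ne').mp this
  have hlim : ∀ a : ℝ, 1 ≤ a → a ≤ c → Tendsto (fun T : ℝ => ∫ y in -T..T, f (a + y * Complex.I))
      atTop (𝓝 (∫ y : ℝ, f (a + y * Complex.I))) := fun a ha hac =>
    intervalIntegral_tendsto_integral (hint' a ha hac) tendsto_neg_atTop_atBot tendsto_id
  have hhor : ∀ σ : ℝ, |σ| = 1 →
      Tendsto (fun T : ℝ => ∫ x in (1 : ℝ)..c, f (x + ((σ * T : ℝ) : ℂ) * Complex.I)) atTop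
        (𝓝 0) := by
    intro σ hσ
    have hzero : Tendsto (fun T : ℝ => M * T ^ (-B) * |c - 1|) atTop (𝓝 0) := by
      have := ((tendsto_rpow_neg_atTop (show 0 < B by linarith)).const_mul M).mul_const |c - 1|
      simpa using this
    refine squeeze_zero_norm' ((eventually_gt_atTop 0).mono fun T hT => ?_) hzero
    refine intervalIntegral.norm_integral_le_of_norm_le_const fun x hx => ?_
    rw [uIoc_of_le hc] at hx
    refine (hM _ (by simpa using hx.1.le) (by simpa using hx.2)).trans ?_
    have hTle : T ≤ ‖(x + ((σ * T : ℝ) : ℂ) * Complex.I : ℂ)‖ := by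
      refine le_trans (le_of_eq ?_) (Complex.abs_im_le_norm _)
      simp [abs_mul, hσ, abs_of_pos hT]
    exact mul_le_mul_of_nonneg_left
      (Real.rpow_le_rpow_of_nonpos hT hTle (by linarith)) hM0
  have hrect : ∀ T : ℝ, (∫ x in (1 : ℝ)..c, f (x + ((-1 * T : ℝ) : ℂ) * Complex.I)) -
      (∫ x in (1 : ℝ)..c, f (x + ((1 * T : ℝ) : ℂ) * Complex.I)) +
      Complex.I • (∫ y in -T..T, f (c + y * Complex.I)) -
      Complex.I • (∫ y in -T..T, f ((1 : ℝ) + y * Complex.I)) = 0 := by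
    intro T
    have h := Complex.integral_boundary_rect_eq_zero_of_differentiableOn f
      ⟨1, -1 * T⟩ ⟨c, 1 * T⟩ (hf.mono fun w hw => ?_)
    · simpa using h
    · have := hw.1
      simp only [mem_preimage, uIcc_of_le hc] at this
      exact lt_of_lt_of_le one_pos this.1
  have htot := ((((hhor (-1) (by simp)).sub (hhor 1 (by simp))).add
    ((hlim c hc le_rfl).const_smul Complex.I)).sub ((hlim 1 le_rfl hc).const_smul Complex.I))
  have hkey := tendsto_nhds_unique htot (tendsto_const_nhds.congr fun T => (hrect T).symm)
  rw [sub_zero, zero_add, ← smul_sub, smul_eq_zero_iff_right Complex.I_ne_zero, sub_eq_zero] at hkey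
  have hscale : ∀ a : ℝ, ∫ ξ : ℝ, f (line a ξ) =
      |(2 * Real.pi)⁻¹| • ∫ y : ℝ, f (a + y * Complex.I) := fun a =>
    Measure.integral_comp_mul_left (fun y : ℝ => f (a + y * Complex.I)) (2 * Real.pi)
  rw [hscale, hscale, hkey]

/-! ### Decay for `α < 2` -/

/-- The three-parameter (Prabhakar) function `E^{j+1}_{α,β}(z) = ∑ C(r+j, j) z ^ r / Γ(α r + β)`
with integral upper parameter. It is the Mittag-Leffler function for `j = 0`. -/
noncomputable def prabhakar (α β : ℝ) (j : ℕ) (z : ℝ) : ℝ :=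
  ∑' r : ℕ, ((r + j).choose j : ℝ) * z ^ r / Real.Gamma (α * r + β)

lemma prabhakar_zero (z : ℝ) : prabhakar α β 0 z = mittagLeffler α β z := by
  simp [prabhakar, mittagLeffler]

lemma summable_prabhakar (hα : 0 < α) (hβ : 0 < β) (j : ℕ) (z : ℝ) :
    Summable fun r : ℕ => ((r + j).choose j : ℝ) * z ^ r / Real.Gamma (α * r + β) := by
  refine ((summable_pow_div_Gamma hα hβ (2 * |z|)).mul_left (2 ^ j)).of_norm_bounded fun r => ?_
  have hG := Real.Gamma_pos_of_pos (gammaArg_pos hα hβ r)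
  have hch : ((r + j).choose j : ℝ) ≤ 2 ^ (r + j) := by
    exact_mod_cast Nat.choose_le_two_pow _ _
  rw [norm_div, norm_mul, norm_pow, Real.norm_of_nonneg hG.le, Real.norm_natCast,
    Real.norm_eq_abs, ← mul_div_assoc]
  refine div_le_div_of_nonneg_right ?_ hG.le
  calc ((r + j).choose j : ℝ) * |z| ^ r ≤ 2 ^ (r + j) * |z| ^ r := by gcongr
    _ = 2 ^ j * (2 * |z|) ^ r := by rw [pow_add, mul_pow]; ring

/-- Lowering the second parameter at the cost of raising the upper one. -/
lemma prabhakar_eq (hα : 0 < α) (hβ : 0 < β) (j : ℕ) (z : ℝ) :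
    prabhakar α β j z = α * (j + 1) * prabhakar α (β + 1) (j + 1) z +
      (β - α * (j + 1)) * prabhakar α (β + 1) j z := by
  have hβ' : 0 < β + 1 := by linarith
  rw [prabhakar, prabhakar, prabhakar, ← tsum_mul_left, ← tsum_mul_left,
    ← ((summable_prabhakar hα hβ' (j + 1) z).mul_left _).tsum_add
      ((summable_prabhakar hα hβ' j z).mul_left _)]
  refine tsum_congr fun r => ?_
  have hs := gammaArg_pos hα hβ r
  have hG := Real.Gamma_pos_of_pos hs
  have hch : ((r : ℝ) + j + 1) * ((r + j).choose j : ℝ) =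
      ((r + (j + 1)).choose (j + 1) : ℝ) * (j + 1) := by
    exact_mod_cast Nat.add_one_mul_choose_eq (r + j) j
  rw [← add_assoc (α * r), Real.Gamma_add_one hs.ne']
  field_simp
  linear_combination (α * z ^ r) * hch

/-- The integrand of the Bromwich integral of `E^{j+1}_{α,B}(-x²)`. -/
noncomputable def bromwichKernel (α B : ℝ) (j : ℕ) (x : ℝ) (w : ℂ) : ℂ :=
  Complex.exp w * w ^ ((-B : ℝ) : ℂ) * (1 / (1 + x ^ 2 * w ^ ((-α : ℝ) : ℂ)) ^ (j + 1))

lemma cos_pos_of_lt_two (hα : 0 < α) (hα2 : α < 2) : 0 < Real.cos (Real.pi * α / 4) := by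
  have := Real.pi_pos
  refine Real.cos_pos_of_mem_Ioo ⟨?_, ?_⟩
  · have : 0 < Real.pi * α / 4 := by positivity
    linarith
  · nlinarith

/-- For `α < 2` and `Re w > 0` the number `w ^ (-α)` stays in a sector about the positive axis whose
half-angle `πα/2` is less than `π`, so `1 + x² w ^ (-α)` is bounded away from zero. -/
lemma le_norm_one_add_mul_cpow (hα : 0 < α) (hα2 : α < 2) (x : ℝ) {w : ℂ} (hw : 0 < w.re) :
    Real.cos (Real.pi * α / 4) * (1 + x ^ 2 * ‖w‖ ^ (-α)) ≤
      ‖1 + (x : ℂ) ^ 2 * w ^ ((-α : ℝ) : ℂ)‖ := by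
  have hw0 : w ≠ 0 := fun h => by simp [h] at hw
  set k := Real.cos (Real.pi * α / 4) with hk
  have hkpos := cos_pos_of_lt_two hα hα2
  set ρ := x ^ 2 * ‖w‖ ^ (-α) with hρ
  have hρ0 : 0 ≤ ρ := by positivity
  set θ := -α * w.arg with hθ
  have hpolar : (x : ℂ) ^ 2 * w ^ ((-α : ℝ) : ℂ) =
      ((ρ * Real.cos θ : ℝ) : ℂ) + ((ρ * Real.sin θ : ℝ) : ℂ) * Complex.I := by
    rw [Complex.cpow_ofReal]
    push_cast [hρ, hθ]
    ring_nf
  have harg : |w.arg| < Real.pi / 2 := Complex.abs_arg_lt_pi_div_two_iff.mpr (Or.inl hw)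
  have hcos : 2 * k ^ 2 - 1 ≤ Real.cos θ := by
    rw [hk, ← Real.cos_two_mul, ← Real.cos_abs θ]
    have hθ' : |θ| ≤ 2 * (Real.pi * α / 4) := by
      rw [hθ, abs_mul, abs_neg, abs_of_pos hα]
      nlinarith
    refine Real.cos_le_cos_of_nonneg_of_le_pi (abs_nonneg _) ?_ hθ'
    nlinarith [Real.pi_pos]
  refine le_of_sq_le_sq ?_ (norm_nonneg _)
  rw [hpolar, Complex.sq_norm, Complex.normSq_apply]
  simp only [Complex.add_re, Complex.one_re, Complex.ofReal_re, Complex.re_ofReal_mul,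
    Complex.I_re, Complex.add_im, Complex.one_im, Complex.ofReal_im, Complex.im_ofReal_mul,
    Complex.I_im]
  have hk1 : k ^ 2 ≤ 1 := by
    have := Real.abs_cos_le_one (Real.pi * α / 4)
    exact (sq_le_one_iff_abs_le_one _).mpr this
  have hsc := Real.sin_sq_add_cos_sq θ
  have h1 : 0 ≤ (1 - k ^ 2) * (1 - ρ) ^ 2 := mul_nonneg (by linarith) (sq_nonneg _)
  have h2 : 0 ≤ ρ * (Real.cos θ - (2 * k ^ 2 - 1)) := mul_nonneg hρ0 (by linarith)
  simp only [mul_zero, mul_one, add_zero, zero_add]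
  linear_combination h1 + 2 * h2 - ρ ^ 2 * hsc

lemma norm_bromwichKernel_le (hα : 0 < α) (hα2 : α < 2) (B : ℝ) (j : ℕ) (x : ℝ) {w : ℂ}
    (hw : 0 < w.re) :
    ‖bromwichKernel α B j x w‖ ≤ Real.exp w.re * ‖w‖ ^ (-B) *
      (((Real.cos (Real.pi * α / 4))⁻¹) ^ (j + 1) * (1 + x ^ 2 * ‖w‖ ^ (-α))⁻¹) := by
  have hkpos := cos_pos_of_lt_two hα hα2
  have hlow := le_norm_one_add_mul_cpow hα hα2 x hw
  have hρ1 : 1 ≤ 1 + x ^ 2 * ‖w‖ ^ (-α) := by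
    have : 0 ≤ x ^ 2 * ‖w‖ ^ (-α) := by positivity
    linarith
  rw [bromwichKernel, norm_mul, norm_mul, Complex.norm_exp, Complex.norm_cpow_real, norm_div,
    norm_one, norm_pow]
  gcongr
  calc 1 / ‖1 + (x : ℂ) ^ 2 * w ^ ((-α : ℝ) : ℂ)‖ ^ (j + 1)
      ≤ 1 / (Real.cos (Real.pi * α / 4) * (1 + x ^ 2 * ‖w‖ ^ (-α))) ^ (j + 1) := by
        gcongr
    _ = ((Real.cos (Real.pi * α / 4))⁻¹) ^ (j + 1) *
          ((1 + x ^ 2 * ‖w‖ ^ (-α)) ^ (j + 1))⁻¹ := by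
        rw [one_div, mul_pow, mul_inv, inv_pow]
    _ ≤ _ := by
        gcongr
        exact le_self_pow₀ hρ1 (by omega)

lemma one_add_mul_cpow_ne_zero (hα : 0 < α) (hα2 : α < 2) (x : ℝ) {w : ℂ} (hw : 0 < w.re) :
    1 + (x : ℂ) ^ 2 * w ^ ((-α : ℝ) : ℂ) ≠ 0 := by
  have hkpos := cos_pos_of_lt_two hα hα2
  refine norm_pos_iff.mp (lt_of_lt_of_le ?_ (le_norm_one_add_mul_cpow hα hα2 x hw))
  positivity

lemma differentiableOn_bromwichKernel (hα : 0 < α) (hα2 : α < 2) (B : ℝ) (j : ℕ) (x : ℝ) :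
    DifferentiableOn ℂ (bromwichKernel α B j x) {w | 0 < w.re} := by
  intro w hw
  have hpow : ∀ s : ℂ, DifferentiableAt ℂ (fun w : ℂ => w ^ s) w := fun s =>
    differentiableAt_id.cpow_const (Or.inl hw)
  refine DifferentiableAt.differentiableWithinAt ?_
  refine (Complex.differentiableAt_exp.mul (hpow _)).mul
    (DifferentiableAt.div (differentiableAt_const _)
      ((((hpow _).const_mul _).const_add 1).pow _) ?_)
  exact pow_ne_zero _ (one_add_mul_cpow_ne_zero hα hα2 x hw)

lemma continuous_bromwichKernel_line (hα : 0 < α) (hα2 : α < 2) (B : ℝ) (j : ℕ) {c : ℝ}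
    (hc : 0 < c) :
    Continuous (Function.uncurry fun x ξ : ℝ => bromwichKernel α B j x (line c ξ)) := by
  have hpow : ∀ s : ℂ, Continuous fun p : ℝ × ℝ => line c p.2 ^ s := fun s =>
    (continuous_line_cpow hc s).comp continuous_snd
  unfold bromwichKernel
  refine (Continuous.mul (by fun_prop) (hpow _)).mul (continuous_const.div ?_ fun p => ?_)
  · exact (continuous_const.add (Continuous.mul (by fun_prop) (hpow _))).pow _
  · exact pow_ne_zero _ (one_add_mul_cpow_ne_zero hα hα2 p.1 (by simpa using hc))

/-- On a line far enough to the right the kernel is a binomial series in `x² w ^ (-α)`, which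
integrates termwise to the Prabhakar series. -/
lemma integral_bromwichKernel_of_lt (hα : 0 < α) {B : ℝ} (hB : 1 < B) (j : ℕ) {x c : ℝ}
    (hc : 1 ≤ c) (hx : x ^ 2 < c ^ α) :
    ∫ ξ : ℝ, bromwichKernel α B j x (line c ξ) = (prabhakar α B j (-x ^ 2) : ℂ) := by
  have hc0 : 0 < c := by linarith
  set ρ := x ^ 2 * c ^ (-α) with hρ
  have hρ0 : 0 ≤ ρ := by positivity
  have hρ1 : ρ < 1 := by
    rw [hρ, Real.rpow_neg hc0.le, ← div_eq_mul_inv, div_lt_one (by positivity)]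
    exact hx
  have hne : ∀ ξ, line c ξ ≠ 0 := fun ξ h => by
    have := congrArg Complex.re h
    simp at this; linarith
  have hq : ∀ ξ : ℝ, ‖-((x : ℂ) ^ 2 * line c ξ ^ ((-α : ℝ) : ℂ))‖ ≤ ρ := fun ξ => by
    rw [norm_neg, norm_mul, Complex.norm_cpow_real, norm_pow, Complex.norm_real, Real.norm_eq_abs,
      sq_abs]
    refine mul_le_mul_of_nonneg_left ?_ (sq_nonneg x)
    exact Real.rpow_le_rpow_of_nonpos hc0 (le_norm_line c ξ) (by linarith)
  set F : ℕ → ℝ → ℂ := fun r ξ => (((r + j).choose j : ℝ) * (-x ^ 2) ^ r : ℝ) *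
    (Complex.exp (line c ξ) * line c ξ ^ ((-(α * r + B) : ℝ) : ℂ)) with hF
  have hFq : ∀ r ξ, F r ξ = Complex.exp (line c ξ) * line c ξ ^ ((-B : ℝ) : ℂ) *
      (((r + j).choose j : ℂ) * (-((x : ℂ) ^ 2 * line c ξ ^ ((-α : ℝ) : ℂ))) ^ r) := by
    intro r ξ
    have hsplit : ((-(α * r + B) : ℝ) : ℂ) = r * ((-α : ℝ) : ℂ) + ((-B : ℝ) : ℂ) := by
      push_cast; ring
    simp only [hF]
    rw [hsplit, Complex.cpow_add _ _ (hne ξ), Complex.cpow_nat_mul, ← neg_mul, mul_pow]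
    push_cast
    ring
  have hBr : ∀ r : ℕ, 1 < α * r + B := fun r => by
    have : 0 ≤ α * r := by positivity
    linarith
  have hnorm : ∀ r ξ, ‖F r ξ‖ ≤
      Real.exp c * ‖line c ξ‖ ^ (-B) * (((r + j).choose j : ℝ) * ρ ^ r) := by
    intro r ξ
    rw [hFq, norm_mul, norm_mul, Complex.norm_exp, Complex.norm_cpow_real, line_re, norm_mul,
      norm_pow, Complex.norm_natCast]
    gcongr
    exact hq ξ
  have hbase := integrable_norm_line_rpow hc hB
  have hFint : ∀ r, Integrable (F r) := fun r => by
    refine ((hbase.const_mul (Real.exp c)).mul_const _).mono' ?_ (.of_forall (hnorm r))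
    have h1 := continuous_line_cpow hc0 ((-(α * r + B) : ℝ) : ℂ)
    exact (continuous_const.mul (Continuous.mul (by fun_prop) h1)).aestronglyMeasurable
  have hgeom := summable_choose_mul_geometric_of_norm_lt_one j (r := ρ)
    (by rwa [Real.norm_of_nonneg hρ0])
  have hFsum : Summable fun r => ∫ ξ, ‖F r ξ‖ := by
    refine Summable.of_nonneg_of_le (fun r => integral_nonneg fun ξ => norm_nonneg _) (fun r => ?_)
      (hgeom.mul_left (∫ ξ : ℝ, Real.exp c * ‖line c ξ‖ ^ (-B)))
    rw [← integral_mul_const]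
    exact integral_mono (hFint r).norm ((hbase.const_mul _).mul_const _) (hnorm r)
  have hpt : ∀ ξ : ℝ, bromwichKernel α B j x (line c ξ) = ∑' r, F r ξ := by
    intro ξ
    simp_rw [hFq]
    rw [tsum_mul_left, tsum_choose_mul_geometric_of_norm_lt_one j ((hq ξ).trans_lt hρ1),
      sub_neg_eq_add, bromwichKernel]
  simp_rw [hpt]
  rw [← integral_tsum_of_summable_integral_norm hFint hFsum, prabhakar, Complex.ofReal_tsum]
  refine tsum_congr fun r => ?_
  simp only [hF]
  rw [integral_const_mul, integral_cexp_mul_cpow_line hc (hBr r), ← Complex.ofReal_mul,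
    div_eq_mul_inv]

/-- For `α < 2` the Bromwich integral may be taken over the single line `Re w = 1` for all `x`. -/
lemma integral_bromwichKernel (hα : 0 < α) (hα2 : α < 2) {B : ℝ} (hB : 1 < B) (j : ℕ) (x : ℝ) :
    ∫ ξ : ℝ, bromwichKernel α B j x (line 1 ξ) = (prabhakar α B j (-x ^ 2) : ℂ) := by
  set c := (1 + x ^ 2) ^ (1 / α) with hcdef
  have hc : 1 ≤ c := Real.one_le_rpow (by nlinarith [sq_nonneg x]) (by positivity)
  have hx : x ^ 2 < c ^ α := by
    rw [hcdef, ← Real.rpow_mul (by positivity), one_div_mul_cancel hα.ne', Real.rpow_one]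
    linarith
  have hkpos := cos_pos_of_lt_two hα hα2
  rw [← integral_bromwichKernel_of_lt hα hB j hc hx]
  refine (integral_line_eq_integral_line_one hB hc (differentiableOn_bromwichKernel hα hα2 B j x)
    (M := Real.exp c * ((Real.cos (Real.pi * α / 4))⁻¹) ^ (j + 1)) fun w hw1 hwc => ?_).symm
  refine (norm_bromwichKernel_le hα hα2 B j x (by linarith)).trans ?_
  have hinv : (1 + x ^ 2 * ‖w‖ ^ (-α))⁻¹ ≤ 1 := by
    refine inv_le_one_of_one_le₀ ?_
    have : 0 ≤ x ^ 2 * ‖w‖ ^ (-α) := by positivity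
    linarith
  calc _ ≤ Real.exp c * ‖w‖ ^ (-B) * (((Real.cos (Real.pi * α / 4))⁻¹) ^ (j + 1) * 1) := by
        gcongr
    _ = _ := by ring

/-- On the line `Re w = 1` the kernel is dominated by a product of a function of `ξ` and the
integrable function `1 / (1 + x²)`. -/
lemma norm_bromwichKernel_line_le (hα : 0 < α) (hα2 : α < 2) (B : ℝ) (j : ℕ) (x ξ : ℝ) :
    ‖bromwichKernel α B j x (line 1 ξ)‖ ≤ (1 + x ^ 2)⁻¹ *
      (Real.exp 1 * ((Real.cos (Real.pi * α / 4))⁻¹) ^ (j + 1) * ‖line 1 ξ‖ ^ (-(B - α))) := by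
  have hkpos := cos_pos_of_lt_two hα hα2
  have h1 := one_le_norm_line le_rfl ξ
  have hn : 0 < ‖line 1 ξ‖ := by linarith
  refine (norm_bromwichKernel_le hα hα2 B j x (by simp)).trans ?_
  have hα1 : 1 ≤ ‖line 1 ξ‖ ^ α := Real.one_le_rpow h1 hα.le
  have hinv : (1 + x ^ 2 * ‖line 1 ξ‖ ^ (-α))⁻¹ ≤ ‖line 1 ξ‖ ^ α * (1 + x ^ 2)⁻¹ := by
    rw [← div_eq_mul_inv, inv_le_comm₀ (by positivity) (by positivity), inv_div,
      Real.rpow_neg hn.le, ← div_eq_mul_inv, div_le_iff₀ (by positivity), add_mul,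
      div_mul_cancel₀ _ (by positivity)]
    linarith
  have hsplit : ‖line 1 ξ‖ ^ (-(B - α)) = ‖line 1 ξ‖ ^ (-B) * ‖line 1 ξ‖ ^ α := by
    rw [← Real.rpow_add hn]; congr 1; ring
  rw [line_re, hsplit]
  calc _ ≤ Real.exp 1 * ‖line 1 ξ‖ ^ (-B) * (((Real.cos (Real.pi * α / 4))⁻¹) ^ (j + 1) *
        (‖line 1 ξ‖ ^ α * (1 + x ^ 2)⁻¹)) := by gcongr
    _ = _ := by ring

lemma integrable_bromwichKernel_bound {B : ℝ} (hB : 1 + α < B) (K : ℝ) :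
    Integrable fun ξ : ℝ => K * ‖line 1 ξ‖ ^ (-(B - α)) :=
  (integrable_norm_line_rpow le_rfl (by linarith)).const_mul K

/-- Quadratic decay of the Prabhakar functions on the negative axis. It is read off the Bromwich
integral for large second parameter; the smaller values are reached by lowering that parameter. -/
lemma exists_abs_prabhakar_le (hα : 0 < α) (hα2 : α < 2) (hβ : 0 < β) (j : ℕ) :
    ∃ C : ℝ, ∀ x : ℝ, |prabhakar α β j (-x ^ 2)| ≤ C * (1 + x ^ 2)⁻¹ := by
  obtain ⟨n, hn⟩ := exists_nat_gt (1 + α - β)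
  induction n generalizing β j with
  | zero =>
    have hB : 1 + α < β := by simpa using hn
    refine ⟨∫ ξ : ℝ, Real.exp 1 * ((Real.cos (Real.pi * α / 4))⁻¹) ^ (j + 1) *
      ‖line 1 ξ‖ ^ (-(β - α)), fun x => ?_⟩
    rw [← Real.norm_eq_abs, ← Complex.norm_real, ← integral_bromwichKernel hα hα2 (by linarith) j x,
      mul_comm, ← integral_const_mul]
    exact norm_integral_le_of_norm_le
      ((integrable_bromwichKernel_bound hB _).const_mul _)
      (.of_forall fun ξ => norm_bromwichKernel_line_le hα hα2 β j x ξ)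
  | succ n ih =>
    push_cast at hn
    obtain ⟨C₁, h₁⟩ := ih (β := β + 1) (by linarith) (j + 1) (by linarith)
    obtain ⟨C₂, h₂⟩ := ih (β := β + 1) (by linarith) j (by linarith)
    refine ⟨|α * (j + 1)| * C₁ + |β - α * (j + 1)| * C₂, fun x => ?_⟩
    rw [prabhakar_eq hα hβ]
    refine (abs_add_le _ _).trans ?_
    rw [abs_mul, abs_mul (β - _), add_mul, mul_assoc |α * _|, mul_assoc |β - _|]
    exact add_le_add (mul_le_mul_of_nonneg_left (h₁ x) (abs_nonneg _))
      (mul_le_mul_of_nonneg_left (h₂ x) (abs_nonneg _))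

lemma integrable_mittagLeffler_neg_sq (hα : 0 < α) (hα2 : α < 2) (hβ : 0 < β) :
    Integrable fun x : ℝ => mittagLeffler α β (-x ^ 2) := by
  obtain ⟨C, hC⟩ := exists_abs_prabhakar_le hα hα2 hβ 0
  refine (integrable_inv_one_add_sq.const_mul C).mono'
    (continuous_mittagLeffler_neg_sq hα hβ).aestronglyMeasurable (.of_forall fun x => ?_)
  rw [← prabhakar_zero]
  exact hC x

/-! ### The value for `α < 2` -/

open Complex in
/-- `∫ dx / (1 + x² / p²) = π p` for `Re p > 0`, from the antiderivative
`(p / 2i) (log (p + i x) - log (p - i x))`. -/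
lemma integral_inv_one_add_sq_mul_inv_sq {p : ℂ} (hp : 0 < p.re)
    (hint : Integrable fun x : ℝ => (1 + (x : ℂ) ^ 2 * (p ^ 2)⁻¹)⁻¹) :
    ∫ x : ℝ, (1 + (x : ℂ) ^ 2 * (p ^ 2)⁻¹)⁻¹ = Real.pi * p := by
  have hp0 : p ≠ 0 := fun h => by simp [h] at hp
  set D : ℝ → ℂ := fun x => log (p + x * I) - log (p - x * I) with hD
  have hslit : ∀ x : ℝ, p + x * I ∈ slitPlane := fun x => Or.inl (by simpa using hp)
  have hslit' : ∀ x : ℝ, p - x * I ∈ slitPlane := fun x => Or.inl (by simpa using hp)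
  have hder : ∀ x : ℝ, HasDerivAt (fun x => p / (2 * I) * D x)
      ((1 + (x : ℂ) ^ 2 * (p ^ 2)⁻¹)⁻¹) x := by
    intro x
    have hx : HasDerivAt (fun x : ℝ => (x : ℂ) * I) I x := by
      simpa using (Complex.ofRealCLM.hasDerivAt (x := x)).mul_const I
    have h1 := (hx.const_add p).clog_real (hslit x)
    have h2 := (hx.const_sub p).clog_real (hslit' x)
    refine ((h1.sub h2).const_mul (p / (2 * I))).congr_deriv ?_
    have n1 := slitPlane_ne_zero (hslit x)
    have n2 := slitPlane_ne_zero (hslit' x)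
    have hprod : (p + x * I) * (p - x * I) = p ^ 2 + x ^ 2 := by
      linear_combination (-(x : ℂ) ^ 2) * I_sq
    have n3 : p ^ 2 + (x : ℂ) ^ 2 ≠ 0 := hprod ▸ mul_ne_zero n1 n2
    have hl : I / (p + x * I) - -I / (p - x * I) = 2 * p * I / (p ^ 2 + x ^ 2) := by
      rw [← hprod, div_sub_div _ _ n1 n2]
      congr 1; ring
    have hr : (1 + (x : ℂ) ^ 2 * (p ^ 2)⁻¹)⁻¹ = p ^ 2 / (p ^ 2 + x ^ 2) := by
      rw [inv_eq_iff_eq_inv, inv_div]; field_simp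
    rw [hl, hr]
    field_simp
  have htop : Tendsto D atTop (𝓝 (Real.pi * I)) := by
    have hdiv : Tendsto (fun x : ℝ => p / x) atTop (𝓝 0) := by
      have h := (Complex.continuous_ofReal.tendsto 0).comp tendsto_inv_atTop_zero
      simpa [Function.comp_def, div_eq_mul_inv] using h.const_mul p
    have hI : Tendsto (fun x : ℝ => log (p / x + I)) atTop (𝓝 (log I)) := by
      refine Tendsto.clog ?_ (Or.inr (by simp))
      simpa using hdiv.add_const I
    have hI' : Tendsto (fun x : ℝ => log (p / x - I)) atTop (𝓝 (log (-I))) := by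
      refine Tendsto.clog ?_ (Or.inr (by simp))
      simpa using hdiv.sub_const I
    have hval : log I - log (-I) = Real.pi * I := by
      rw [log_I, log_neg_I]; ring
    rw [← hval]
    refine (hI.sub hI').congr' ((eventually_gt_atTop 0).mono fun x hx => ?_)
    -- the real factor `x` contributes `log x` to both logarithms
    have hxne : (x : ℂ) ≠ 0 := by exact_mod_cast hx.ne'
    have e1 : p + x * I = x * (p / x + I) := by field_simp
    have e2 : p - x * I = x * (p / x - I) := by field_simp
    have n1 : p / x + I ≠ 0 := fun h => slitPlane_ne_zero (hslit x) (by rw [e1, h, mul_zero])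
    have n2 : p / x - I ≠ 0 := fun h => slitPlane_ne_zero (hslit' x) (by rw [e2, h, mul_zero])
    simp only [hD]
    rw [e1, e2, log_ofReal_mul hx n1, log_ofReal_mul hx n2]
    ring
  have hodd : ∀ x : ℝ, D (-x) = -D x := fun x => by
    simp only [hD]
    push_cast
    rw [neg_mul, sub_neg_eq_add, ← sub_eq_add_neg, neg_sub]
  have hbot : Tendsto D atBot (𝓝 (-(Real.pi * I))) := by
    refine ((htop.comp tendsto_neg_atBot_atTop).neg).congr fun x => ?_
    rw [Function.comp_apply, hodd, neg_neg]
  rw [integral_of_hasDerivAt_of_tendsto hder hint (hbot.const_mul _) (htop.const_mul _)]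
  field_simp
  ring

/-- The value of the integral for large `β`, by interchanging it with the Bromwich integral. -/
lemma integral_mittagLeffler_neg_sq_of_lt (hα : 0 < α) (hα2 : α < 2) (hβ : 1 + α < β) :
    ∫ x : ℝ, mittagLeffler α β (-x ^ 2) = Real.pi / Real.Gamma (β - α / 2) := by
  have hkpos := cos_pos_of_lt_two hα hα2
  have hprod : Integrable (Function.uncurry fun x ξ : ℝ => bromwichKernel α β 0 x (line 1 ξ))
      (volume.prod volume) := by
    refine (integrable_inv_one_add_sq.mul_prod (integrable_bromwichKernel_bound hβ
      (Real.exp 1 * ((Real.cos (Real.pi * α / 4))⁻¹) ^ (0 + 1)))).mono'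
      (continuous_bromwichKernel_line hα hα2 β 0 one_pos).aestronglyMeasurable
      (.of_forall fun p => norm_bromwichKernel_line_le hα hα2 β 0 p.1 p.2)
  have hinner : ∀ ξ : ℝ, ∫ x : ℝ, bromwichKernel α β 0 x (line 1 ξ) =
      Real.pi * (Complex.exp (line 1 ξ) * line 1 ξ ^ ((-(β - α / 2) : ℝ) : ℂ)) := by
    intro ξ
    have hw : 0 < (line 1 ξ).re := by simp
    have hw0 : line 1 ξ ≠ 0 := fun h => by simp [h] at hw
    set p := line 1 ξ ^ ((α / 2 : ℝ) : ℂ) with hp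
    have hpsq : (p ^ 2)⁻¹ = line 1 ξ ^ ((-α : ℝ) : ℂ) := by
      rw [hp, ← Complex.cpow_nat_mul, ← Complex.cpow_neg]
      congr 1; push_cast; ring
    have hpre : 0 < p.re := by
      have harg : |(line 1 ξ).arg| < Real.pi / 2 :=
        Complex.abs_arg_lt_pi_div_two_iff.mpr (Or.inl hw)
      rw [abs_lt] at harg
      rw [hp, Complex.cpow_ofReal_re]
      have : 0 < ‖line 1 ξ‖ := norm_pos_iff.mpr hw0
      refine mul_pos (by positivity) (Real.cos_pos_of_mem_Ioo ⟨?_, ?_⟩) <;> nlinarith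
    have hker : ∀ x : ℝ, bromwichKernel α β 0 x (line 1 ξ) =
        Complex.exp (line 1 ξ) * line 1 ξ ^ ((-β : ℝ) : ℂ) *
          (1 + (x : ℂ) ^ 2 * (p ^ 2)⁻¹)⁻¹ := fun x => by
      rw [bromwichKernel, hpsq, zero_add, pow_one, one_div]
    have hint : Integrable fun x : ℝ => (1 + (x : ℂ) ^ 2 * (p ^ 2)⁻¹)⁻¹ := by
      have hne : Complex.exp (line 1 ξ) * line 1 ξ ^ ((-β : ℝ) : ℂ) ≠ 0 :=
        mul_ne_zero (Complex.exp_ne_zero _) (by simp [Complex.cpow_eq_zero_iff, hw0])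
      have hi : Integrable fun x : ℝ => bromwichKernel α β 0 x (line 1 ξ) := by
        refine (integrable_inv_one_add_sq.mul_const _).mono' ?_
          (.of_forall fun x => norm_bromwichKernel_line_le hα hα2 β 0 x ξ)
        exact ((continuous_bromwichKernel_line hα hα2 β 0 one_pos).comp
          (by fun_prop : Continuous fun x : ℝ => (x, ξ))).aestronglyMeasurable
      simp_rw [hker] at hi
      exact (integrable_const_mul_iff (IsUnit.mk0 _ hne) _).mp hi
    simp_rw [hker]
    rw [integral_const_mul, integral_inv_one_add_sq_mul_inv_sq hpre hint]
    have hexp : line 1 ξ ^ ((-(β - α / 2) : ℝ) : ℂ) = line 1 ξ ^ ((-β : ℝ) : ℂ) * p := by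
      rw [hp, ← Complex.cpow_add _ _ hw0]
      congr 1; push_cast; ring
    rw [hexp]; ring
  have hswap := integral_integral_swap hprod
  simp_rw [hinner, integral_bromwichKernel hα hα2 (show 1 < β by linarith) 0] at hswap
  rw [integral_const_mul, integral_cexp_mul_cpow_line le_rfl (by linarith),
    integral_complex_ofReal] at hswap
  simp_rw [prabhakar_zero] at hswap
  rw [div_eq_mul_inv]
  exact_mod_cast hswap

lemma tendsto_oddSeries_altCoeff_of_lt_two (hα : 0 < α) (hα2 : α < 2) (hβ : 0 < β) :
    Tendsto (oddSeries altCoeff α β) atTop (𝓝 0) := by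
  obtain ⟨C, hC⟩ := exists_abs_prabhakar_le hα hα2 hβ 0
  have hlim : Tendsto (fun x : ℝ => |C| * x⁻¹) atTop (𝓝 0) := by
    simpa using tendsto_inv_atTop_zero.const_mul |C|
  refine squeeze_zero_norm' ((eventually_gt_atTop 0).mono fun x hx => ?_) hlim
  rw [← mul_mittagLeffler_neg_sq, ← prabhakar_zero, norm_mul, Real.norm_of_nonneg hx.le,
    Real.norm_eq_abs]
  calc x * |prabhakar α β 0 (-x ^ 2)| ≤ x * (|C| * (x ^ 2)⁻¹) := by
        refine mul_le_mul_of_nonneg_left ((hC x).trans ?_) hx.le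
        gcongr
        · exact le_abs_self C
        · linarith
    _ = _ := by field_simp

lemma inv_Gamma_eq_mul_inv_Gamma_add_one (s : ℝ) :
    (Real.Gamma s)⁻¹ = s * (Real.Gamma (s + 1))⁻¹ := by
  rcases eq_or_ne s 0 with rfl | hs
  · simp [Real.Gamma_zero]
  · rw [Real.Gamma_add_one hs, mul_inv, mul_inv_cancel_left₀ hs]

/-- The limit of the primitive for `α < 2`, by descent in `β`. -/
lemma tendsto_oddSeries_intCoeff_of_lt_two (hα : 0 < α) (hα2 : α < 2) (hβ : 0 < β) :
    Tendsto (oddSeries intCoeff α β) atTop (𝓝 (Real.pi / Real.Gamma (β - α / 2) / 2)) := by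
  obtain ⟨n, hn⟩ := exists_nat_gt (1 + α - β)
  induction n generalizing β with
  | zero =>
    have hB : 1 + α < β := by simpa using hn
    rw [← hasImproperIntegral_iff_tendsto hα hβ, ← integral_mittagLeffler_neg_sq_of_lt hα hα2 hB]
    have hint := integrable_mittagLeffler_neg_sq hα hα2 hβ
    exact ⟨fun a b => hint.intervalIntegrable,
      intervalIntegral_tendsto_integral hint tendsto_fst tendsto_snd⟩
  | succ n ih =>
    push_cast at hn
    have hβ' : 0 < β + 1 := by linarith
    have h := ((ih hβ' (by linarith)).const_mul (β - α / 2)).add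
      ((tendsto_oddSeries_altCoeff_of_lt_two hα hα2 hβ').const_mul (α / 2))
    rw [funext (oddSeries_intCoeff_eq hα hβ)]
    convert h using 2
    rw [div_eq_mul_inv Real.pi, inv_Gamma_eq_mul_inv_Gamma_add_one,
      show β - α / 2 + 1 = β + 1 - α / 2 by ring]
    ring

end

/-! ### The integral of the Mittag-Leffler function -/

theorem mainTheorem2 (α β : ℝ) (hα : 0 < α) (hβ : 0 < β) :
    -- the two series converge, and the Mittag-Leffler function is the Borel transform
    -- of the Bessel-Wright function
    (∀ x : ℝ,
      Summable (fun r : ℕ => x ^ r / Real.Gamma (α * r + β)) ∧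
      Summable (fun r : ℕ =>
        x ^ r / ((r.factorial : ℝ) * Real.Gamma (α * r + (β - 1) + 1))) ∧
      IntegrableOn (fun s : ℝ => Real.exp (-s) * besselWright α (β - 1) (x * s)) (Ioi 0) ∧
      mittagLeffler α β x =
        ∫ s in Ioi (0 : ℝ), Real.exp (-s) * besselWright α (β - 1) (x * s)) ∧
    -- whenever the improper integral converges, it has the stated value
    (∀ I : ℝ, HasImproperIntegral (fun x => mittagLeffler α β (-x ^ 2)) I →
      I = Real.pi / Real.Gamma (β - α / 2)) ∧
    -- the exact range of convergence
    ((∃ I : ℝ, HasImproperIntegral (fun x => mittagLeffler α β (-x ^ 2)) I) ↔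
      α < 2 ∨ (α = 2 ∧ 1 < β)) ∧
    -- for `α < 2` the integral is absolutely convergent
    (α < 2 →
      Integrable (fun x : ℝ => mittagLeffler α β (-x ^ 2)) ∧
      ∫ x : ℝ, mittagLeffler α β (-x ^ 2) = Real.pi / Real.Gamma (β - α / 2)) := by
  have hconv : (∃ I : ℝ, HasImproperIntegral (fun x => mittagLeffler α β (-x ^ 2)) I) →
      α < 2 ∨ (α = 2 ∧ 1 < β) := by
    rintro ⟨I, hI⟩
    rw [hasImproperIntegral_iff_tendsto hα hβ] at hI
    rcases lt_trichotomy α 2 with h | rfl | h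
    · exact Or.inl h
    · refine Or.inr ⟨rfl, not_le.mp fun h1 => ?_⟩
      exact not_tendsto_oddSeries_two hβ h1 _ hI
    · exact absurd hI (not_tendsto_oddSeries_of_two_lt h hβ _)
  have hvalue : α < 2 ∨ (α = 2 ∧ 1 < β) →
      HasImproperIntegral (fun x => mittagLeffler α β (-x ^ 2))
        (Real.pi / Real.Gamma (β - α / 2)) := by
    intro h
    rw [hasImproperIntegral_iff_tendsto hα hβ]
    rcases h with h | ⟨rfl, h⟩
    · exact tendsto_oddSeries_intCoeff_of_lt_two hα h hβ
    · rw [div_self two_ne_zero, div_right_comm]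
      exact tendsto_oddSeries_intCoeff_two h
  refine ⟨fun x => ⟨summable_pow_div_Gamma hα hβ x, ?_,
      integrableOn_exp_neg_mul_besselWright hα hβ x,
      mittagLeffler_eq_integral_besselWright hα hβ x⟩, fun I hI => ?_,
    ⟨hconv, fun h => ⟨_, hvalue h⟩⟩, fun h => ?_⟩
  · simpa only [add_assoc, sub_add_cancel] using summable_besselWright hα hβ x
  · exact tendsto_nhds_unique hI.2 (hvalue (hconv ⟨I, hI⟩)).2
  · have hint := integrable_mittagLeffler_neg_sq hα h hβ
    exact ⟨hint, tendsto_nhds_unique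
      (intervalIntegral_tendsto_integral hint tendsto_fst tendsto_snd) (hvalue (Or.inl h)).2⟩
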